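/- A bigraph is a finite simple bipartite graph $F=(V,E)$ together with an ordered bipartition $(A,B)$ of $V$, every edge $e$ having one endpoint $a(e)\in A$ and one endpoint $b(e)\in B$. For a bounded Lebesgue measurable function $U:[0,1]^2\to\mathbb{R}$ (not necessarily symmetric) put $$t(F,U)=\int_{[0,1]^{V}}\ \prod_{e\in E}U\bigl(x_{a(e)},x_{b(e)}\bigr)\ \prod_{v\in V}dx_v .$$ Let $C_{2k}$ denote the cycle with $2k$ nodes, with its two alternating classes (the value $t(C_{2k},U)$ does not depend on their order). Lemma. Let $F$ be a bigraph in which every node has degree at least $2$, whose girth (the length of a shortest cycle) is $2r$, and which is neither a single cycle nor a complete bipartite graph. Then for every Lebesgue measurable function $U:[0,1]^2\to[-1,1]$, $$t(F,U)\ \le\ t(C_{2r},U)\, t(C_4,U)^{1/4}.$$ -/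

import Mathlib

open MeasureTheory
open scoped unitInterval

/-- The class `𝓦₁`: functions `[0,1]² → [-1,1]` that are measurable with respect to Lebesgue measure
(`AEMeasurable` for the Lebesgue measure is the same as Lebesgue measurability). They need not be
symmetric. -/
structure IsUnitKernel (U : I × I → ℝ) : Prop where
  aemeasurable : AEMeasurable U volume
  mem_Icc : ∀ p, U p ∈ Set.Icc (-1 : ℝ) 1

open Classical in
/-- The density `t(F, U)` of a finite simple bigraph `F` in `U : [0,1]² → ℝ`. A bigraph is a graph
together with an ordered bipartition, given here by a proper colouring `c` with colours `true`
(first class `A`) and `false` (second class `B`). Each edge `e` of `F` corresponds to exactly one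
pair `(a(e), b(e))` of adjacent nodes with `a(e) ∈ A` (and hence `b(e) ∈ B`), and
`t(F, U) = ∫_{[0,1]^V} ∏_e U(x_{a(e)}, x_{b(e)}) dx`. -/
noncomputable def bigraphDensity {V : Type*} [Fintype V] (F : SimpleGraph V)
    (c : F.Coloring Bool) (U : I × I → ℝ) : ℝ :=
  ∫ x : V → I, ∏ e : V × V with F.Adj e.1 e.2 ∧ c e.1 = true, U (x e.1, x e.2)

/-- `t(C_{2k}, U)`, for the cycle with `2k` nodes (meaningful for `k ≥ 2`), whose two classes are
the nodes of even and of odd index. -/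
noncomputable def evenCycleDensity (k : ℕ) (U : I × I → ℝ) : ℝ :=
  bigraphDensity (SimpleGraph.cycleGraph (2 * k))
    (SimpleGraph.cycleGraph.bicoloring_of_even (2 * k) (even_two_mul k)) U

/-- `F` is a single cycle. -/
def IsSingleCycle {V : Type*} (F : SimpleGraph V) : Prop :=
  ∃ n : ℕ, 3 ≤ n ∧ Nonempty (F ≃g SimpleGraph.cycleGraph n)

/-- `F` is a complete bipartite graph `K_{a,b}`. -/
def IsCompleteBipartiteGraph {V : Type*} (F : SimpleGraph V) : Prop :=
  ∃ a b : ℕ, Nonempty (F ≃g completeBipartiteGraph (Fin a) (Fin b))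

/-! Cauchy-Schwarz estimates: a shortest cycle of F is kept for the factor t(C_{2r}), and the factor
t^{1/4} is extracted from the rest of F. Here t = t(C_4, U), which is the integral of the squared
codegree (`codegreeSq`).

Weights of modulus at most 1 at the nodes of C_{2r} cannot push the absolute value of the density
above t(C_{2r}). Let M be the supremum of these absolute values. Reflection in the axis through 0
and r bounds the square of a weighted density by the product of two reflected ones, whose weights on
the axis are trivial; one factor is estimated by M. So M² ≤ K M, hence M ≤ K, where K bounds the
densities with a longer run of trivial weights; in the end all weights are trivial
(`abs_weightedCycle_le`). The reflection tolerates a further bounded factor that depends on two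
antipodal nodes (`abs_integral_antipodal_cycle_le`). A shortest cycle of F is induced, so once the
variables off the cycle are fixed, every other edge is a weight at one node or a constant
(`abs_integral_mul_edgeProd_le`).

If 2r ≥ 6, a node off the cycle has at most one neighbour on it, so some edge wz avoids the cycle,
and the nodes of the cycle joined to w or z lie in an antipodal pair. Integrating over x_w and x_z
leaves a function of modulus at most t^{1/4}, which serves as the antipodal factor.

If 2r = 4, there are non-adjacent w and b in different classes. A 4-cycle cannot contain both; after
exchanging the classes if necessary, it misses w. Let K be the integral over x_w of the edges at w,
a function of the coordinates in N(w), and G the conditional expectation of the other edges given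
these coordinates. Two edges at w give ‖K‖₂² ≤ t, two edges at b give |G| ≤ t^{1/2}, and the 4-cycle
tested against the sign of G gives ‖G‖₁ ≤ t. Hence |∫ K G| ≤ t^{1/2} · t^{3/4} = t^{5/4}. -/

/-- Measurable functions with values in `[-1, 1]`. -/
structure IsUnitBounded {α : Type*} [MeasurableSpace α] (f : α → ℝ) : Prop where
  meas : Measurable f
  bound : ∀ x, |f x| ≤ 1

/-! ### Closure properties of functions bounded by 1. -/

namespace IsUnitBounded

variable {α β κ : Type*} [MeasurableSpace α] [MeasurableSpace β] {f g : α → ℝ}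

theorem const {a : ℝ} (ha : |a| ≤ 1) : IsUnitBounded (fun _ : α => a) :=
  ⟨measurable_const, fun _ => ha⟩

theorem one : IsUnitBounded (fun _ : α => (1 : ℝ)) := const (by simp)

theorem mul (hf : IsUnitBounded f) (hg : IsUnitBounded g) : IsUnitBounded (fun x => f x * g x) :=
  ⟨hf.meas.mul hg.meas, fun x => by
    rw [abs_mul]; exact mul_le_one₀ (hf.bound x) (abs_nonneg _) (hg.bound x)⟩

theorem sq (hf : IsUnitBounded f) : IsUnitBounded (fun x => f x ^ 2) := by
  simpa only [pow_two] using hf.mul hf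

theorem abs (hf : IsUnitBounded f) : IsUnitBounded (fun x => |f x|) :=
  ⟨hf.meas.abs, fun x => by simpa using hf.bound x⟩

theorem comp (hf : IsUnitBounded f) {h : β → α} (hh : Measurable h) :
    IsUnitBounded (fun x => f (h x)) :=
  ⟨hf.meas.comp hh, fun _ => hf.bound _⟩

theorem prod {f : κ → α → ℝ} (s : Finset κ) (hf : ∀ k ∈ s, IsUnitBounded (f k)) :
    IsUnitBounded (fun x => ∏ k ∈ s, f k x) :=
  ⟨Finset.measurable_fun_prod s fun k hk => (hf k hk).meas, fun x => by
    rw [Finset.abs_prod]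
    exact Finset.prod_le_one (fun _ _ => abs_nonneg _) fun k hk => (hf k hk).bound x⟩

theorem integrable (hf : IsUnitBounded f) (μ : Measure α) [IsFiniteMeasure μ] : Integrable f μ :=
  Integrable.of_bound hf.meas.aestronglyMeasurable 1 (.of_forall hf.bound)

theorem abs_integral_le (hf : IsUnitBounded f) (μ : Measure α) [IsProbabilityMeasure μ] :
    |∫ x, f x ∂μ| ≤ 1 := by
  have := norm_integral_le_of_norm_le_const (μ := μ) (f := f) (C := 1) (.of_forall hf.bound)
  simpa using this

theorem integral_right {f : α × β → ℝ} (hf : IsUnitBounded f) (μ : Measure β)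
    [IsProbabilityMeasure μ] : IsUnitBounded (fun x => ∫ y, f (x, y) ∂μ) :=
  ⟨(hf.meas.stronglyMeasurable.integral_prod_right' (ν := μ)).measurable,
    fun _ => (hf.comp measurable_prodMk_left).abs_integral_le μ⟩

theorem integral_left {f : β × α → ℝ} (hf : IsUnitBounded f) (μ : Measure β)
    [IsProbabilityMeasure μ] : IsUnitBounded (fun x => ∫ y, f (y, x) ∂μ) :=
  (hf.comp measurable_swap).integral_right μ

end IsUnitBounded

/-! ### Cauchy-Schwarz and Fubini for bounded functions. -/

section Fubini

variable {α β : Type*} [MeasurableSpace α] [MeasurableSpace β]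

/-- The Cauchy-Schwarz inequality for bounded functions. -/
theorem integral_mul_sq_le {μ : Measure α} [IsProbabilityMeasure μ] {f g : α → ℝ}
    (hf : IsUnitBounded f) (hg : IsUnitBounded g) :
    (∫ x, f x * g x ∂μ) ^ 2 ≤ (∫ x, f x ^ 2 ∂μ) * ∫ x, g x ^ 2 ∂μ := by
  have key : ∀ t : ℝ, 0 ≤ (∫ x, f x ^ 2 ∂μ) * (t * t) + (2 * ∫ x, f x * g x ∂μ) * t
      + ∫ x, g x ^ 2 ∂μ := by
    intro t
    have h : 0 ≤ ∫ x, (t * f x + g x) ^ 2 ∂μ := integral_nonneg fun x => sq_nonneg _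
    have e : ∀ x, (t * f x + g x) ^ 2 = (t * t) * f x ^ 2 + (2 * t) * (f x * g x) + g x ^ 2 :=
      fun x => by ring
    simp only [e] at h
    have i1 := (hf.sq.integrable μ).const_mul (t * t)
    have i2 := ((hf.mul hg).integrable μ).const_mul (2 * t)
    have i3 := hg.sq.integrable μ
    have i12 : Integrable (fun x => t * t * f x ^ 2 + 2 * t * (f x * g x)) μ := i1.add i2
    rw [integral_add i12 i3, integral_add i1 i2,
      integral_const_mul, integral_const_mul] at h
    linarith
  have := discrim_le_zero key
  rw [discrim] at this
  nlinarith

theorem integral_sq_integral {μ : Measure α} [IsProbabilityMeasure μ] {ν : Measure β}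
    [IsProbabilityMeasure ν] {f : α × β → ℝ} (hf : IsUnitBounded f) :
    ∫ y, (∫ x, f (x, y) ∂μ) ^ 2 ∂ν = ∫ x, ∫ x', ∫ y, f (x, y) * f (x', y) ∂ν ∂μ ∂μ := by
  have h3 : IsUnitBounded (fun p : (α × α) × β => f (p.1.1, p.2) * f (p.1.2, p.2)) :=
    (hf.comp (by fun_prop)).mul (hf.comp (by fun_prop))
  calc ∫ y, (∫ x, f (x, y) ∂μ) ^ 2 ∂ν
      = ∫ y, ∫ p : α × α, f (p.1, y) * f (p.2, y) ∂(μ.prod μ) ∂ν := by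
        congr 1; ext y
        rw [pow_two, integral_prod_mul (fun x => f (x, y)) (fun x => f (x, y))]
    _ = ∫ p : α × α, ∫ y, f (p.1, y) * f (p.2, y) ∂ν ∂(μ.prod μ) :=
        integral_integral_swap ((h3.comp measurable_swap).integrable (ν.prod (μ.prod μ)))
    _ = _ := integral_prod _ ((h3.integral_right ν).integrable _)

theorem integral_comp_measurePreserving {μ : Measure α} {ν : Measure β} {h : α → β}
    (mp : MeasurePreserving h μ ν) {f : β → ℝ} (hf : IsUnitBounded f) :
    ∫ x, f (h x) ∂μ = ∫ y, f y ∂ν := by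
  rw [← mp.map_eq, integral_map mp.measurable.aemeasurable hf.meas.aestronglyMeasurable]

end Fubini

/-! ### Resampling coordinates: conditional expectation and independence. -/

section Resampling

variable {V κ Ω : Type*}

open Classical in
theorem measurable_extend [MeasurableSpace Ω] (i : κ → V) :
    Measurable (fun p : (V → Ω) × (κ → Ω) => Function.extend i p.2 p.1) := by
  refine measurable_pi_lambda _ fun v => ?_
  by_cases h : ∃ k, i k = v
  · simp only [Function.extend_def, h, dif_pos]
    fun_prop
  · simp only [Function.extend_def, h, dif_neg, not_false_iff]
    fun_prop

theorem piecewise_eq_extend (S : Set V) [∀ v, Decidable (v ∈ S)] (x z : V → Ω) :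
    S.piecewise z x = Function.extend (Subtype.val : S → V) (z ∘ Subtype.val) x := by
  ext v
  by_cases hv : v ∈ S
  · rw [Set.piecewise_eq_of_mem _ _ _ hv]
    exact (Subtype.val_injective.extend_apply (z ∘ (Subtype.val : S → V)) x ⟨v, hv⟩).symm
  · rw [Set.piecewise_eq_of_notMem _ _ _ hv, Function.extend_apply']
    simpa using hv

theorem measurable_piecewise_pair [MeasurableSpace Ω] (S : Set V) [∀ v, Decidable (v ∈ S)] :
    Measurable (fun p : (V → Ω) × (V → Ω) => S.piecewise p.2 p.1) := by
  refine measurable_pi_lambda _ fun v => ?_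
  by_cases hv : v ∈ S
  · simp only [Set.piecewise_eq_of_mem _ _ _ hv]; fun_prop
  · simp only [Set.piecewise_eq_of_notMem _ _ _ hv]; fun_prop

theorem measurable_piecewise_left [MeasurableSpace Ω] (S : Set V) [∀ v, Decidable (v ∈ S)]
    (x : V → Ω) : Measurable (fun z : V → Ω => S.piecewise z x) :=
  (measurable_piecewise_pair S).comp measurable_prodMk_left

theorem DependsOn.piecewise_compl {f : (V → Ω) → ℝ} {S L : Set V} [∀ v, Decidable (v ∈ Sᶜ)]
    (hf : DependsOn f (S ∪ L)) (x : V → Ω) : DependsOn (fun z => f (Sᶜ.piecewise z x)) L := by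
  intro z z' h
  refine hf fun v hv => ?_
  by_cases hvS : v ∈ S
  · rw [Set.piecewise_eq_of_notMem _ _ _ (by simpa), Set.piecewise_eq_of_notMem _ _ _ (by simpa)]
  · rw [Set.piecewise_eq_of_mem _ _ _ hvS, Set.piecewise_eq_of_mem _ _ _ hvS]
    exact h v (hv.resolve_left hvS)

theorem piecewise_compl_comp {S : Set V} [∀ v, Decidable (v ∈ Sᶜ)] {τ : Equiv.Perm V}
    (hτ : ∀ v ∈ S, τ v = v) (x z : V → Ω) :
    Sᶜ.piecewise z x ∘ τ = Sᶜ.piecewise (z ∘ τ) x := by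
  ext v
  by_cases hv : v ∈ S
  · have hv' : v ∉ Sᶜ := by simpa
    rw [Function.comp_apply, hτ v hv, Set.piecewise_eq_of_notMem _ _ _ hv',
      Set.piecewise_eq_of_notMem _ _ _ hv']
  · have hτv : τ v ∈ Sᶜ := fun h => hv (by have := τ.injective (hτ _ h); rwa [this] at h)
    rw [Function.comp_apply, Set.piecewise_eq_of_mem _ _ _ hτv, Set.piecewise_eq_of_mem _ _ _ hv,
      Function.comp_apply]

variable [Fintype V] [Fintype κ] [MeasureSpace Ω]
  [IsProbabilityMeasure (volume : Measure Ω)]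

open Classical in
/-- Resampling the coordinates in the range of `i` does not change the distribution. -/
theorem measurePreserving_extend {i : κ → V} (hi : i.Injective) :
    MeasurePreserving (fun p : (V → Ω) × (κ → Ω) => Function.extend i p.2 p.1) := by
  refine ⟨measurable_extend i, ?_⟩
  refine (Measure.pi_eq fun s hs => ?_).symm
  rw [Measure.map_apply (measurable_extend i) (MeasurableSet.univ_pi hs)]
  -- The preimage of a box is again a box: the overwritten coordinates of the first argument become
  -- free.
  have : (fun p : (V → Ω) × (κ → Ω) => Function.extend i p.2 p.1) ⁻¹' Set.univ.pi s =
      (Set.univ.pi fun v => if v ∈ Set.range i then Set.univ else s v) ×ˢ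
        (Set.univ.pi fun k => s (i k)) := by
    ext ⟨x, y⟩
    simp only [Set.mem_preimage, Set.mem_pi, Set.mem_univ, true_implies, Set.mem_prod]
    constructor
    · intro h
      refine ⟨fun v => ?_, fun k => ?_⟩
      · split_ifs with hv
        · trivial
        · have := h v
          rwa [Function.extend_apply' _ _ _ hv] at this
      · have := h (i k)
        rwa [hi.extend_apply] at this
    · rintro ⟨h1, h2⟩ v
      by_cases hv : v ∈ Set.range i
      · obtain ⟨k, rfl⟩ := hv
        rw [hi.extend_apply]; exact h2 k
      · have := h1 v
        rw [if_neg hv] at this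
        rwa [Function.extend_apply' _ _ _ hv]
  rw [this]
  change (volume.prod volume) _ = _
  rw [Measure.prod_prod]
  change (Measure.pi _) _ * (Measure.pi _) _ = _
  rw [Measure.pi_pi, Measure.pi_pi]
  have h1 : ∏ k, (volume : Measure Ω) (s (i k)) =
      ∏ v, if v ∈ Set.range i then (volume : Measure Ω) (s v) else 1 := by
    rw [Finset.prod_ite, Finset.prod_const_one, mul_one]
    refine Finset.prod_nbij i (by simp) (hi.injOn) (fun v hv => by simpa using hv) (by simp)
  rw [h1, ← Finset.prod_mul_distrib]
  refine Finset.prod_congr rfl fun v _ => ?_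
  split_ifs <;> simp

theorem integral_extend {i : κ → V} (hi : i.Injective) {f : (V → Ω) → ℝ} (hf : IsUnitBounded f) :
    ∫ x, ∫ y : κ → Ω, f (Function.extend i y x) = ∫ x, f x := by
  rw [← integral_comp_measurePreserving (measurePreserving_extend hi) hf]
  symm
  exact integral_prod _ ((hf.comp (measurable_extend i)).integrable (volume.prod volume))

theorem measurePreserving_comp_injective {i : κ → V} (hi : i.Injective) :
    MeasurePreserving (fun x : V → Ω => x ∘ i) := by
  have hm : Measurable (fun x : V → Ω => x ∘ i) := by fun_prop
  refine ⟨hm, ?_⟩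
  have mp := measurePreserving_extend (Ω := Ω) hi
  conv_lhs => rw [← mp.map_eq]
  rw [Measure.map_map hm mp.measurable]
  have : (fun x : V → Ω => x ∘ i) ∘ (fun p : (V → Ω) × (κ → Ω) => Function.extend i p.2 p.1)
      = Prod.snd := by
    ext p k; simp [hi.extend_apply]
  rw [this]
  change Measure.map Prod.snd (volume.prod volume) = _
  simp

theorem integral_piecewise (S : Set V) [∀ v, Decidable (v ∈ S)] {f : (V → Ω) → ℝ}
    (hf : IsUnitBounded f) :
    ∫ x, ∫ z, f (S.piecewise z x) = ∫ x, f x := by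
  classical
  rw [← integral_extend (Subtype.val_injective : (Subtype.val : S → V).Injective) hf]
  congr 1; ext x
  simp only [piecewise_eq_extend]
  exact integral_comp_measurePreserving (measurePreserving_comp_injective (Ω := Ω)
    (Subtype.val_injective : (Subtype.val : S → V).Injective))
    (hf.comp ((measurable_extend Subtype.val).comp (measurable_prodMk_left (x := x))))

open Classical in
/-- Functions of disjoint sets of coordinates are independent. -/
theorem integral_mul_of_dependsOn {S T : Set V} (hST : Disjoint S T) {f g : (V → Ω) → ℝ}
    (hf : IsUnitBounded f) (hg : IsUnitBounded g) (hfS : DependsOn f S) (hgT : DependsOn g T) :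
    ∫ x, f x * g x = (∫ x, f x) * ∫ x, g x := by
  rw [← integral_piecewise S (hf.mul hg)]
  have h : ∀ x z : V → Ω, f (S.piecewise z x) * g (S.piecewise z x) = f z * g x := by
    intro x z
    congr 1
    · exact hfS fun v hv => Set.piecewise_eq_of_mem _ _ _ hv
    · exact hgT fun v hv => Set.piecewise_eq_of_notMem _ _ _ (hST.notMem_of_mem_right hv)
  simp only [h, integral_mul_const, integral_const_mul]

end Resampling

/-! ### Reflection of coordinates. -/

section Reflection

variable {V Ω : Type*} [Fintype V] [MeasureSpace Ω] [IsProbabilityMeasure (volume : Measure Ω)]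

-- Given the coordinates in S, the two factors depend on the disjoint sets L and R, so they are
-- independent, and τ carries one conditional distribution to the other. This is also the source of
-- positivity.
open Classical in
theorem integral_mul_comp_reflection {S L R : Set V} {τ : Equiv.Perm V}
    (hτ : ∀ v ∈ S, τ v = v) (hτL : ∀ v ∈ L, τ v ∈ R) (hLR : Disjoint L R)
    {f : (V → Ω) → ℝ} (hf : IsUnitBounded f) (hfd : DependsOn f (S ∪ L)) :
    ∫ x, f x * f (x ∘ τ) = ∫ x, (∫ z, f (Sᶜ.piecewise z x)) ^ 2 := by
  have hm : Measurable (fun x : V → Ω => x ∘ τ) := by fun_prop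
  rw [← integral_piecewise Sᶜ (hf.mul (hf.comp hm))]
  congr 1; ext x
  have hfx := hf.comp (measurable_piecewise_left Sᶜ x)
  have hfd' : DependsOn (fun x : V → Ω => f (x ∘ τ)) (S ∪ R) := by
    intro z z' h
    refine hfd fun v hv => h _ ?_
    rcases hv with hv | hv
    · left; rwa [hτ v hv]
    · right; exact hτL v hv
  refine (integral_mul_of_dependsOn hLR hfx
    ((hf.comp hm).comp (measurable_piecewise_left Sᶜ x)) (hfd.piecewise_compl x)
    (hfd'.piecewise_compl x)).trans ?_
  rw [pow_two]
  congr 1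
  simp only [piecewise_compl_comp hτ]
  exact integral_comp_measurePreserving (measurePreserving_comp_injective τ.injective) hfx

open Classical in
/-- The Cauchy-Schwarz inequality for a reflection `τ` with axis `S` that exchanges the two
sides `L` and `R`. -/
theorem integral_reflection_sq_le {S L R : Set V} {τ : Equiv.Perm V}
    (hτ : ∀ v ∈ S, τ v = v) (hτL : ∀ v ∈ L, τ v ∈ R) (hτR : ∀ v ∈ R, τ v ∈ L)
    (hLR : Disjoint L R) {s f g : (V → Ω) → ℝ}
    (hs : IsUnitBounded s) (hf : IsUnitBounded f) (hg : IsUnitBounded g)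
    (hsd : DependsOn s S) (hfd : DependsOn f (S ∪ L)) (hgd : DependsOn g (S ∪ R)) :
    (∫ x, s x * (f x * g x)) ^ 2 ≤ (∫ x, f x * f (x ∘ τ)) * ∫ x, g x * g (x ∘ τ) := by
  rw [integral_mul_comp_reflection hτ hτL hLR hf hfd,
    integral_mul_comp_reflection hτ hτR hLR.symm hg hgd,
    ← integral_piecewise Sᶜ (hs.mul (hf.mul hg))]
  have hA : ∀ {f : (V → Ω) → ℝ}, IsUnitBounded f →
      IsUnitBounded (fun x => ∫ z, f (Sᶜ.piecewise z x)) := fun hf =>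
    (hf.comp (measurable_piecewise_pair Sᶜ)).integral_right volume
  have e : ∀ x : V → Ω, ∫ z, s (Sᶜ.piecewise z x) *
        (f (Sᶜ.piecewise z x) * g (Sᶜ.piecewise z x)) =
      (s x * ∫ z, f (Sᶜ.piecewise z x)) * ∫ z, g (Sᶜ.piecewise z x) := by
    intro x
    have hsx : ∀ z, s (Sᶜ.piecewise z x) = s x := fun z =>
      hsd fun v hv => Set.piecewise_eq_of_notMem _ _ _ (by simpa)
    simp only [hsx]
    rw [integral_const_mul, mul_assoc, integral_mul_of_dependsOn hLR
      (hf.comp (measurable_piecewise_left Sᶜ x)) (hg.comp (measurable_piecewise_left Sᶜ x))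
      (hfd.piecewise_compl x) (hgd.piecewise_compl x)]
  simp only [e]
  -- Cauchy-Schwarz is applied to the conditional expectations given the axis; s goes with the first
  -- one and is dropped because |s| ≤ 1.
  refine (integral_mul_sq_le (hs.mul (hA hf)) (hA hg)).trans ?_
  refine mul_le_mul_of_nonneg_right ?_ (integral_nonneg fun x => sq_nonneg _)
  refine integral_mono ((hs.mul (hA hf)).sq.integrable _) ((hA hf).sq.integrable _) fun x => ?_
  simp only [mul_pow]
  refine mul_le_of_le_one_left (sq_nonneg _) ?_
  exact (sq_le_one_iff_abs_le_one _).2 (hs.bound x)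

end Reflection

/-! ### Iterated integrals over few variables. -/

section FinIntegrals

theorem measurable_fin_cons {Ω : Type*} [MeasurableSpace Ω] {n : ℕ} (a : Ω) :
    Measurable (fun y : Fin n → Ω => (Fin.cons a y : Fin (n + 1) → Ω)) := by
  refine measurable_pi_lambda _ fun v => ?_
  refine Fin.cases ?_ (fun v => ?_) v
  · simp
  · simp only [Fin.cons_succ]; fun_prop

variable {Ω : Type*} [MeasureSpace Ω] [IsProbabilityMeasure (volume : Measure Ω)]

theorem integral_fin_succ {n : ℕ} {f : (Fin (n + 1) → Ω) → ℝ} (hf : IsUnitBounded f) :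
    ∫ y, f y = ∫ a, ∫ y : Fin n → Ω, f (Fin.cons a y) := by
  have mp := (volume_preserving_piFinSuccAbove (fun _ : Fin (n + 1) => Ω) 0).symm
  rw [← integral_comp_measurePreserving mp hf]
  refine (integral_prod _ ((hf.comp mp.measurable).integrable (volume.prod volume))).trans ?_
  simp only [MeasurableEquiv.piFinSuccAbove, MeasurableEquiv.symm_mk, MeasurableEquiv.coe_mk,
    Equiv.symm_symm, Fin.insertNthEquiv_zero]
  rfl

theorem integral_fin_zero (f : (Fin 0 → Ω) → ℝ) : ∫ y, f y = f ![] := by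
  rw [integral_unique]
  simp [Subsingleton.elim default (![] : Fin 0 → Ω)]

theorem integral_fin_two {f : (Fin 2 → Ω) → ℝ} (hf : IsUnitBounded f) :
    ∫ y, f y = ∫ a, ∫ b, f ![a, b] := by
  rw [integral_fin_succ hf]
  congr 1; ext a
  rw [integral_fin_succ (hf.comp (measurable_fin_cons a))]
  simp only [integral_fin_zero]
  rfl

theorem integral_fin_three {f : (Fin 3 → Ω) → ℝ} (hf : IsUnitBounded f) :
    ∫ y, f y = ∫ a, ∫ b, ∫ c, f ![a, b, c] := by
  rw [integral_fin_succ hf]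
  congr 1; ext a
  rw [integral_fin_two (hf.comp (measurable_fin_cons a))]
  rfl

theorem integral_fin_four {f : (Fin 4 → Ω) → ℝ} (hf : IsUnitBounded f) :
    ∫ y, f y = ∫ a, ∫ b, ∫ c, ∫ d, f ![a, b, c, d] := by
  rw [integral_fin_succ hf]
  congr 1; ext a
  rw [integral_fin_three (hf.comp (measurable_fin_cons a))]
  rfl

end FinIntegrals

/-! ### Bounds of small subgraphs by the density of the 4-cycle. -/

section FourCycle

variable {Ω : Type*} [MeasureSpace Ω]

/-- The integral of the square of the codegree function of `U`. -/
noncomputable def codegreeSq (U : Ω × Ω → ℝ) : ℝ :=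
  ∫ p : Ω × Ω, (∫ b, U (p.1, b) * U (p.2, b)) ^ 2

theorem codegreeSq_nonneg (U : Ω × Ω → ℝ) : 0 ≤ codegreeSq U :=
  integral_nonneg fun _ => sq_nonneg _

variable [IsProbabilityMeasure (volume : Measure Ω)]

variable {U : Ω × Ω → ℝ}

theorem isUnitBounded_codegree (hU : IsUnitBounded U) :
    IsUnitBounded (fun p : Ω × Ω => ∫ b, U (p.1, b) * U (p.2, b)) :=
  IsUnitBounded.integral_right (f := fun q : (Ω × Ω) × Ω => U (q.1.1, q.2) * U (q.1.2, q.2))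
    ((hU.comp (by fun_prop)).mul (hU.comp (by fun_prop))) volume

theorem isUnitBounded_integral_left (hU : IsUnitBounded U) {f : Ω → ℝ} (hf : IsUnitBounded f) :
    IsUnitBounded (fun b => ∫ a, U (a, b) * f a) :=
  IsUnitBounded.integral_left (f := fun q : Ω × Ω => U q * f q.1)
    (hU.mul (hf.comp measurable_fst)) volume

theorem integral_sq_le_one {α : Type*} [MeasurableSpace α] {μ : Measure α}
    [IsProbabilityMeasure μ] {f : α → ℝ} (hf : IsUnitBounded f) : ∫ x, f x ^ 2 ∂μ ≤ 1 :=
  (le_abs_self _).trans (hf.sq.abs_integral_le μ)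

/-- Opening the square pairs the codegree with f(a) f(a'), and Cauchy-Schwarz removes the bounded
weights. -/
theorem integral_integral_left_sq_le (hU : IsUnitBounded U) {f : Ω → ℝ} (hf : IsUnitBounded f) :
    ∫ b, (∫ a, U (a, b) * f a) ^ 2 ≤ √(codegreeSq U) := by
  have hk : IsUnitBounded (fun q : Ω × Ω => U q * f q.1) := hU.mul (hf.comp measurable_fst)
  have hc := isUnitBounded_codegree hU
  have hff : IsUnitBounded (fun p : Ω × Ω => f p.1 * f p.2) :=
    (hf.comp measurable_fst).mul (hf.comp measurable_snd)
  have e : ∫ b, (∫ a, U (a, b) * f a) ^ 2 =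
      ∫ p : Ω × Ω, (f p.1 * f p.2) * ∫ b, U (p.1, b) * U (p.2, b) := by
    refine (integral_sq_integral hk).trans ?_
    refine Eq.trans ?_ (integral_prod _ ((hff.mul hc).integrable (volume.prod volume))).symm
    congr 1; ext a; congr 1; ext a'
    dsimp only
    rw [← integral_const_mul]
    congr 1; ext b; ring
  rw [e]
  refine Real.le_sqrt_of_sq_le ?_
  refine (integral_mul_sq_le hff hc).trans ?_
  exact mul_le_of_le_one_left (codegreeSq_nonneg U) (integral_sq_le_one hff)

/-- A path of two edges with arbitrary weights at its nodes: Cauchy-Schwarz in the middle variable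
reduces it to the preceding estimate for each of its edges. -/
theorem abs_integral_path_le (hU : IsUnitBounded U) {f g h : Ω → ℝ} (hf : IsUnitBounded f)
    (hg : IsUnitBounded g) (hh : IsUnitBounded h) :
    |∫ b, h b * (∫ a, U (a, b) * f a) * ∫ a, U (a, b) * g a| ≤ √(codegreeSq U) := by
  have hF := isUnitBounded_integral_left hU hf
  have hG := isUnitBounded_integral_left hU hg
  refine abs_le_of_sq_le_sq ?_ (Real.sqrt_nonneg _)
  refine (integral_mul_sq_le (hh.mul hF) hG).trans ?_
  rw [pow_two]
  refine mul_le_mul ?_ (integral_integral_left_sq_le hU hg)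
    (integral_nonneg fun _ => sq_nonneg _) (Real.sqrt_nonneg _)
  refine le_trans ?_ (integral_integral_left_sq_le hU hf)
  refine integral_mono ((hh.mul hF).sq.integrable _) (hF.sq.integrable _) fun b => ?_
  simp only [mul_pow]
  exact mul_le_of_le_one_left (sq_nonneg _) ((sq_le_one_iff_abs_le_one _).2 (hh.bound b))

/-- A single weighted edge: this is the bound of the cut norm by t(C_4)^{1/4}. -/
theorem abs_integral_edge_le (hU : IsUnitBounded U) {f h : Ω → ℝ} (hf : IsUnitBounded f)
    (hh : IsUnitBounded h) :
    |∫ a, ∫ b, U (a, b) * (f a * h b)| ≤ √√(codegreeSq U) := by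
  have hF := isUnitBounded_integral_left hU hf
  have e : ∫ a, ∫ b, U (a, b) * (f a * h b) = ∫ b, h b * ∫ a, U (a, b) * f a := by
    rw [integral_integral_swap]
    · congr 1; ext b
      rw [← integral_const_mul]
      congr 1; ext a; ring
    · exact (hU.mul ((hf.comp measurable_fst).mul (hh.comp measurable_snd))).integrable
        (volume.prod volume)
  rw [e]
  refine Real.abs_le_sqrt ((integral_mul_sq_le hh hF).trans ?_)
  calc _ ≤ 1 * √(codegreeSq U) :=
        mul_le_mul (integral_sq_le_one hh) (integral_integral_left_sq_le hU hf)
          (integral_nonneg fun _ => sq_nonneg _) zero_le_one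
    _ = _ := one_mul _

/-- Opening the square turns this into an average of the squared codegree in the other class with
weight h(a) h(a'). Since the square is nonnegative, the weight can be dropped without loss. -/
theorem integral_weighted_codegree_sq_le (hU : IsUnitBounded U) {h : Ω → ℝ}
    (hh : IsUnitBounded h) :
    ∫ p : Ω × Ω, (∫ a, U (a, p.1) * U (a, p.2) * h a) ^ 2 ≤ codegreeSq U := by
  have hk : IsUnitBounded (fun q : Ω × (Ω × Ω) => U (q.1, q.2.1) * U (q.1, q.2.2) * h q.1) :=
    ((hU.comp (by fun_prop)).mul (hU.comp (by fun_prop))).mul (hh.comp (by fun_prop))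
  have hc := (isUnitBounded_codegree hU).sq
  have hff : IsUnitBounded (fun p : Ω × Ω => h p.1 * h p.2) :=
    (hh.comp measurable_fst).mul (hh.comp measurable_snd)
  have e : ∫ p : Ω × Ω, (∫ a, U (a, p.1) * U (a, p.2) * h a) ^ 2 =
      ∫ p : Ω × Ω, (h p.1 * h p.2) * (∫ b, U (p.1, b) * U (p.2, b)) ^ 2 := by
    refine (integral_sq_integral hk).trans ?_
    refine Eq.trans ?_ (integral_prod _ ((hff.mul hc).integrable (volume.prod volume))).symm
    congr 1; ext a; congr 1; ext a'
    dsimp only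
    have e2 := integral_prod_mul (μ := (volume : Measure Ω)) (ν := (volume : Measure Ω))
      (fun b => U (a, b) * U (a', b)) (fun b => U (a, b) * U (a', b))
    rw [pow_two, ← e2, ← integral_const_mul]
    congr 1; ext b; ring
  rw [e]
  refine integral_mono ((hff.mul hc).integrable _) (hc.integrable _) fun p => ?_
  exact mul_le_of_le_one_left (sq_nonneg _) ((le_abs_self _).trans (hff.bound p))

end FourCycle

/-! ### Cycles with weights at the nodes, and their reflections. -/

section CycleDensity

theorem Fin.val_neg_eq_ite {n : ℕ} (i : Fin n) : (-i).val = if i.val = 0 then 0 else n - i.val := by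
  rw [Fin.val_neg']
  split_ifs with h
  · simp [h]
  · exact Nat.mod_eq_of_lt (by omega)

variable {Ω : Type*} {n : ℕ} [NeZero n]

theorem Fin.val_add_one_eq_ite (hn : 2 ≤ n) (i : Fin n) :
    (i + 1).val = if i.val + 1 = n then 0 else i.val + 1 := by
  have h1 : (1 : Fin n).val = 1 := by
    rw [Fin.val_one', Nat.mod_eq_of_lt (by omega)]
  rw [Fin.val_add, h1]
  split_ifs with h
  · rw [h, Nat.mod_self]
  · exact Nat.mod_eq_of_lt (by omega)

theorem Fin.rev_eq_neg_add_one (hn : 2 ≤ n) (i : Fin n) : i.rev = -(i + 1) := by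
  ext
  have := i.isLt
  have h := Fin.val_add_one_eq_ite hn i
  rw [Fin.val_neg_eq_ite, Fin.val_rev]
  split_ifs at h ⊢ <;> omega

theorem alternating_neg {c : Fin n → Bool} (hc : ∀ i, c (i + 1) = !c i) (i : Fin n) :
    c (-i) = c i := by
  have h : ∀ k : ℕ, c (-(Fin.ofNat n k)) = c (Fin.ofNat n k) := by
    intro k
    induction k with
    | zero => congr 1; ext; simp
    | succ k ih =>
      have e : Fin.ofNat n (k + 1) = Fin.ofNat n k + 1 := by
        ext; simp [Fin.val_add]
      have e2 : -(Fin.ofNat n k) = -(Fin.ofNat n k + 1) + 1 := by abel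
      rw [e, hc, ← ih, e2, hc, Bool.not_not]
  simpa using h i.val

/-- The factor of the density of a cycle that belongs to the edge from `i` to `i + 1`; the
colouring `c` tells which endpoint is the first argument of `U`. -/
def cycleFactor (U : Ω × Ω → ℝ) (c : Fin n → Bool) (i : Fin n) (y : Fin n → Ω) : ℝ :=
  if c i then U (y i, y (i + 1)) else U (y (i + 1), y i)

/-- The reflection negates nodes, so it carries the edge from i to i + 1 to the one from -(i + 1) to
-i, whose number is `i.rev`. Negation keeps colours, but the edge is now traversed from its other
end. -/
theorem cycleFactor_comp_neg (U : Ω × Ω → ℝ) {c : Fin n → Bool} (hn : 2 ≤ n)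
    (hc : ∀ i, c (i + 1) = !c i) (i : Fin n) (y : Fin n → Ω) :
    cycleFactor U c i (y ∘ Neg.neg) = cycleFactor U c i.rev y := by
  have h : i.rev + 1 = -i := by rw [Fin.rev_eq_neg_add_one hn]; abel
  have h2 : c i.rev = !c i := by
    rw [Fin.rev_eq_neg_add_one hn, alternating_neg hc, hc]
  simp only [cycleFactor, h2, h, Function.comp_apply, ← Fin.rev_eq_neg_add_one hn]
  cases c i <;> simp

/-- The weights of the cycle that results from reflecting the half `0, …, r`. -/
noncomputable def reflectWeights (r : ℕ) (d : Fin n → Ω → ℝ) (i : Fin n) : Ω → ℝ :=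
  if 0 < i.val ∧ i.val < r then d i else if r < i.val then d (-i) else fun _ => 1

theorem reflectWeights_eq_one {n r : ℕ} (hn : n = 2 * r) {d : Fin n → Ω → ℝ}
    (h : ∀ i, 1 ≤ i.val → i.val ≤ r - 1 → d i = fun _ => 1) :
    reflectWeights r d = fun _ _ => 1 := by
  funext i
  rw [reflectWeights]
  split_ifs with h1 h2
  · exact h i h1.1 (by omega)
  · have h3 := Fin.val_neg_eq_ite i
    rw [if_neg (by omega)] at h3
    exact h _ (by omega) (by omega)
  · rfl

/-- The weights and the edges of one half of a cycle. -/
noncomputable def halfCycle (U : Ω × Ω → ℝ) (c : Fin n → Bool) (r : ℕ) (d : Fin n → Ω → ℝ)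
    (y : Fin n → Ω) : ℝ :=
  (∏ i : Fin n with 0 < i.val ∧ i.val < r, d i (y i)) *
    ∏ i : Fin n with i.val < r, cycleFactor U c i y

theorem prod_eq_prod_axis_mul_prod_neg {r : ℕ} (hn : n = 2 * r) (φ : Fin n → ℝ) :
    ∏ i, φ i = (∏ i : Fin n with i.val = 0 ∨ i.val = r, φ i) *
      ((∏ i : Fin n with 0 < i.val ∧ i.val < r, φ i) *
        ∏ i : Fin n with 0 < i.val ∧ i.val < r, φ (-i)) := by
  rw [← Finset.prod_filter_mul_prod_filter_not Finset.univ
    (fun i : Fin n => i.val = 0 ∨ i.val = r)]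
  congr 1
  rw [← Finset.prod_filter_mul_prod_filter_not _ (fun i : Fin n => i.val < r)]
  congr 1
  · rw [Finset.filter_filter]
    refine Finset.prod_congr (Finset.filter_congr fun i _ => ?_) fun _ _ => rfl
    omega
  · rw [Finset.filter_filter]
    refine Finset.prod_nbij' (fun i => -i) (fun i => -i) ?_ ?_ (by simp) (by simp) (by simp)
    all_goals
      intro i hi
      simp only [Finset.mem_filter, Finset.mem_univ, true_and, Fin.val_neg_eq_ite] at hi ⊢
      split_ifs <;> omega

theorem prod_eq_prod_lt_mul_prod_rev {n r : ℕ} (hn : n = 2 * r) (φ : Fin n → ℝ) :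
    ∏ i, φ i = (∏ i : Fin n with i.val < r, φ i) * ∏ i : Fin n with i.val < r, φ i.rev := by
  rw [← Finset.prod_filter_mul_prod_filter_not Finset.univ (fun i : Fin n => i.val < r)]
  congr 1
  refine Finset.prod_nbij' Fin.rev Fin.rev ?_ ?_ (by simp) (by simp) (by simp)
  all_goals
    intro i hi
    simp only [Finset.mem_filter, Finset.mem_univ, true_and, Fin.val_rev] at hi ⊢
    omega

/-- Half a cycle carries weights only strictly between 0 and r; this is why the doubled half has
trivial weights on the axis. -/
theorem halfCycle_mul_halfCycle_neg {U : Ω × Ω → ℝ} {r : ℕ} (hn : n = 2 * r) (hr : 2 ≤ r)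
    {c : Fin n → Bool} (hc : ∀ i, c (i + 1) = !c i) (d : Fin n → Ω → ℝ) (y : Fin n → Ω) :
    halfCycle U c r d y * halfCycle U c r d (y ∘ Neg.neg) =
      (∏ i, reflectWeights r d i (y i)) * ∏ i, cycleFactor U c i y := by
  have e1 : ∏ i : Fin n with i.val = 0 ∨ i.val = r, reflectWeights r d i (y i) = 1 := by
    refine Finset.prod_eq_one fun i hi => ?_
    have hi := (Finset.mem_filter.1 hi).2
    rw [reflectWeights, if_neg (by omega), if_neg (by omega)]
  have e2 : ∏ i : Fin n with 0 < i.val ∧ i.val < r, reflectWeights r d i (y i) =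
      ∏ i : Fin n with 0 < i.val ∧ i.val < r, d i (y i) := by
    refine Finset.prod_congr rfl fun i hi => ?_
    rw [reflectWeights, if_pos (Finset.mem_filter.1 hi).2]
  have e3 : ∏ i : Fin n with 0 < i.val ∧ i.val < r, reflectWeights r d (-i) (y (-i)) =
      ∏ i : Fin n with 0 < i.val ∧ i.val < r, d i (y (-i)) := by
    refine Finset.prod_congr rfl fun i hi => ?_
    have hi := (Finset.mem_filter.1 hi).2
    have h1 := Fin.val_neg_eq_ite i
    rw [if_neg (by omega)] at h1
    rw [reflectWeights, if_neg (by omega), if_pos (by omega), neg_neg]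
  rw [prod_eq_prod_axis_mul_prod_neg hn fun i => reflectWeights r d i (y i), e1, e2, e3,
    prod_eq_prod_lt_mul_prod_rev hn fun i => cycleFactor U c i y]
  simp only [halfCycle, cycleFactor_comp_neg U (by omega : 2 ≤ n) hc, Function.comp_apply]
  ring

theorem halfCycle_mul_axis {U : Ω × Ω → ℝ} {r : ℕ} (hn : n = 2 * r) (hr : 2 ≤ r)
    {c : Fin n → Bool} (hc : ∀ i, c (i + 1) = !c i) (d : Fin n → Ω → ℝ) (y : Fin n → Ω) :
    (∏ i : Fin n with i.val = 0 ∨ i.val = r, d i (y i)) *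
        (halfCycle U c r d y * halfCycle U c r (fun i => d (-i)) (y ∘ Neg.neg)) =
      (∏ i, d i (y i)) * ∏ i, cycleFactor U c i y := by
  rw [prod_eq_prod_axis_mul_prod_neg hn fun i => d i (y i),
    prod_eq_prod_lt_mul_prod_rev hn fun i => cycleFactor U c i y]
  simp only [halfCycle, cycleFactor_comp_neg U (by omega : 2 ≤ n) hc, Function.comp_apply]
  ring

theorem dependsOn_halfCycle {U : Ω × Ω → ℝ} (c : Fin n → Bool) {r : ℕ} (hn : n = 2 * r) (hr : 2 ≤ r)
    (d : Fin n → Ω → ℝ) : DependsOn (halfCycle U c r d) {i | i.val ≤ r} := by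
  intro y z h
  have h' : ∀ i : Fin n, i.val ≤ r → y i = z i := h
  unfold halfCycle
  congr 1
  · refine Finset.prod_congr rfl fun i hi => ?_
    rw [h' i (Finset.mem_filter.1 hi).2.2.le]
  · refine Finset.prod_congr rfl fun i hi => ?_
    have hi := (Finset.mem_filter.1 hi).2
    have h2 : (i + 1).val ≤ r := by
      rw [Fin.val_add_one_eq_ite (by omega)]; split_ifs <;> omega
    rw [cycleFactor, cycleFactor, h' i hi.le, h' _ h2]

variable [MeasureSpace Ω]

theorem isUnitBounded_cycleFactor {U : Ω × Ω → ℝ} (hU : IsUnitBounded U) (c : Fin n → Bool)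
    (i : Fin n) : IsUnitBounded (cycleFactor U c i) := by
  unfold cycleFactor
  cases c i
  · exact hU.comp (by fun_prop)
  · exact hU.comp (by fun_prop)

/-- The density of a cycle with weights at its nodes. -/
noncomputable def weightedCycle (U : Ω × Ω → ℝ) (c : Fin n → Bool) (d : Fin n → Ω → ℝ) : ℝ :=
  ∫ y : Fin n → Ω, (∏ i, d i (y i)) * ∏ i, cycleFactor U c i y

variable {U : Ω × Ω → ℝ}

theorem isUnitBounded_weightedCycle_integrand (hU : IsUnitBounded U) (c : Fin n → Bool)
    {d : Fin n → Ω → ℝ} (hd : ∀ i, IsUnitBounded (d i)) :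
    IsUnitBounded (fun y : Fin n → Ω => (∏ i, d i (y i)) * ∏ i, cycleFactor U c i y) :=
  (IsUnitBounded.prod _ fun i _ => (hd i).comp (by fun_prop)).mul
    (IsUnitBounded.prod _ fun i _ => isUnitBounded_cycleFactor hU c i)

theorem isUnitBounded_reflectWeights {n : ℕ} (r : ℕ) {d : Fin n → Ω → ℝ}
    (hd : ∀ i, IsUnitBounded (d i)) (i : Fin n) : IsUnitBounded (reflectWeights r d i) := by
  unfold reflectWeights
  split_ifs
  · exact hd _
  · exact hd _
  · exact .one

theorem isUnitBounded_halfCycle (hU : IsUnitBounded U) (c : Fin n → Bool) (r : ℕ)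
    {d : Fin n → Ω → ℝ} (hd : ∀ i, IsUnitBounded (d i)) : IsUnitBounded (halfCycle U c r d) :=
  (IsUnitBounded.prod _ fun i _ => (hd i).comp (by fun_prop)).mul
    (IsUnitBounded.prod _ fun i _ => isUnitBounded_cycleFactor hU c i)

variable [IsProbabilityMeasure (volume : Measure Ω)]

theorem weightedCycle_rotate (hU : IsUnitBounded U) (c : Fin n → Bool) {d : Fin n → Ω → ℝ}
    (hd : ∀ i, IsUnitBounded (d i)) :
    weightedCycle U (fun i => c (i + 1)) (fun i => d (i + 1)) = weightedCycle U c d := by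
  rw [weightedCycle, weightedCycle]
  rw [← integral_comp_measurePreserving
    (measurePreserving_comp_injective (Ω := Ω) (Equiv.addRight (1 : Fin n)).injective)
    (isUnitBounded_weightedCycle_integrand hU _ fun i => hd (i + 1))]
  congr 1; ext y
  congr 1
  · exact Equiv.prod_comp (Equiv.addRight (1 : Fin n)) fun i => d i (y i)
  · exact Equiv.prod_comp (Equiv.addRight (1 : Fin n)) fun i => cycleFactor U c i y

/-- The Cauchy-Schwarz inequality for the reflection of a cycle. -/
theorem cycle_reflection_sq_le {r : ℕ} (hn : n = 2 * r) (hr : 2 ≤ r) (hU : IsUnitBounded U)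
    {c : Fin n → Bool} (hc : ∀ i, c (i + 1) = !c i) {d : Fin n → Ω → ℝ}
    (hd : ∀ i, IsUnitBounded (d i)) {s : (Fin n → Ω) → ℝ} (hs : IsUnitBounded s)
    (hsd : DependsOn s {i | i.val = 0 ∨ i.val = r}) :
    (∫ y, s y * ((∏ i, d i (y i)) * ∏ i, cycleFactor U c i y)) ^ 2 ≤
      weightedCycle U c (reflectWeights r d) *
        weightedCycle U c (reflectWeights r fun i => d (-i)) := by
  set s' : (Fin n → Ω) → ℝ := fun y => s y * ∏ i : Fin n with i.val = 0 ∨ i.val = r, d i (y i)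
    with hs'
  have hm : Measurable (fun y : Fin n → Ω => y ∘ (Equiv.neg (Fin n))) := by fun_prop
  have hf := isUnitBounded_halfCycle hU c r hd
  have hg0 := isUnitBounded_halfCycle hU c r fun i => hd (-i)
  have hg := hg0.comp hm
  have hs'b : IsUnitBounded s' := hs.mul (.prod _ fun i _ => (hd i).comp (by fun_prop))
  have hs'd : DependsOn s' {i | i.val = 0 ∨ i.val = r} := by
    intro y z h
    simp only [hs']
    rw [hsd h]
    congr 1
    refine Finset.prod_congr rfl fun i hi => ?_
    rw [h i (Finset.mem_filter.1 hi).2]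
  have hfd := dependsOn_halfCycle (U := U) c hn hr d
  have hgd := dependsOn_halfCycle (U := U) c hn hr (fun i => d (-i))
  have key := integral_reflection_sq_le (τ := Equiv.neg (Fin n))
    (S := {i : Fin n | i.val = 0 ∨ i.val = r}) (L := {i : Fin n | 0 < i.val ∧ i.val < r})
    (R := {i : Fin n | r < i.val}) ?_ ?_ ?_ ?_ hs'b hf hg hs'd ?_ ?_
  · have e1 : ∀ y : Fin n → Ω, s y * ((∏ i, d i (y i)) * ∏ i, cycleFactor U c i y) =
        s' y * (halfCycle U c r d y *
          halfCycle U c r (fun i => d (-i)) (y ∘ Equiv.neg (Fin n))) := by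
      intro y
      rw [← halfCycle_mul_axis hn hr hc, ← mul_assoc]
      rfl
    simp only [e1]
    refine key.trans (le_of_eq ?_)
    congr 1
    · exact integral_congr_ae (.of_forall fun y => halfCycle_mul_halfCycle_neg hn hr hc d y)
    · rw [weightedCycle]
      congr 1; ext y
      rw [← halfCycle_mul_halfCycle_neg hn hr hc, mul_comm]
      congr 2
      ext i; simp
  · intro i hi
    ext
    simp only [Set.mem_ofPred_eq, Equiv.neg_apply, Fin.val_neg_eq_ite] at hi ⊢
    split_ifs <;> omega
  · intro i hi
    simp only [Set.mem_ofPred_eq, Equiv.neg_apply, Fin.val_neg_eq_ite] at hi ⊢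
    split_ifs <;> omega
  · intro i hi
    simp only [Set.mem_ofPred_eq, Equiv.neg_apply, Fin.val_neg_eq_ite] at hi ⊢
    split_ifs <;> omega
  · rw [Set.disjoint_left]
    intro i hi hi'
    simp only [Set.mem_ofPred_eq] at hi hi'
    omega
  · refine hfd.mono fun i hi => ?_
    simp only [Set.mem_ofPred_eq, Set.mem_union] at hi ⊢
    omega
  · intro y z h
    refine hgd fun i hi => h _ ?_
    simp only [Set.mem_ofPred_eq, Set.mem_union, Equiv.neg_apply, Fin.val_neg_eq_ite] at hi ⊢
    split_ifs <;> omega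

/-- The extremal argument, with M the supremum over all weights and colourings. By `h`, densities of
type P are at most √(K M); by `hP`, this carries over to all densities, so M ≤ √(K M) and M ≤ K. -/
theorem abs_weightedCycle_le_of_sq_le (hU : IsUnitBounded U)
    (P : (Fin n → Bool) → (Fin n → Ω → ℝ) → Prop) {K : ℝ} (hK0 : 0 ≤ K)
    (hP : ∀ K', (∀ c : Fin n → Bool, (∀ i, c (i + 1) = !c i) → ∀ d : Fin n → Ω → ℝ,
        (∀ i, IsUnitBounded (d i)) → P c d → |weightedCycle U c d| ≤ K') →
      ∀ c : Fin n → Bool, (∀ i, c (i + 1) = !c i) → ∀ d : Fin n → Ω → ℝ,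
        (∀ i, IsUnitBounded (d i)) → |weightedCycle U c d| ≤ K')
    (h : ∀ M, (∀ c : Fin n → Bool, (∀ i, c (i + 1) = !c i) → ∀ d : Fin n → Ω → ℝ,
        (∀ i, IsUnitBounded (d i)) → |weightedCycle U c d| ≤ M) →
      ∀ c : Fin n → Bool, (∀ i, c (i + 1) = !c i) → ∀ d : Fin n → Ω → ℝ,
        (∀ i, IsUnitBounded (d i)) → P c d → weightedCycle U c d ^ 2 ≤ K * M)
    (c : Fin n → Bool) (hc : ∀ i, c (i + 1) = !c i) (d : Fin n → Ω → ℝ)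
    (hd : ∀ i, IsUnitBounded (d i)) : |weightedCycle U c d| ≤ K := by
  -- The supremum ranges over both alternating colourings, because a rotation by one step exchanges
  -- them.
  let X : Set ℝ := {t | ∃ c : Fin n → Bool, (∀ i, c (i + 1) = !c i) ∧
    ∃ d : Fin n → Ω → ℝ, (∀ i, IsUnitBounded (d i)) ∧ t = |weightedCycle U c d|}
  have hX : BddAbove X := by
    refine ⟨1, ?_⟩
    rintro _ ⟨c, -, d, hd, rfl⟩
    exact (isUnitBounded_weightedCycle_integrand hU c hd).abs_integral_le volume
  have hM : ∀ c : Fin n → Bool, (∀ i, c (i + 1) = !c i) → ∀ d : Fin n → Ω → ℝ,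
      (∀ i, IsUnitBounded (d i)) → |weightedCycle U c d| ≤ sSup X :=
    fun c hc d hd => le_csSup hX ⟨c, hc, d, hd, rfl⟩
  have hM0 : 0 ≤ sSup X := (abs_nonneg _).trans (hM c hc d hd)
  have hall := hP (√(K * sSup X)) fun c hc d hd hcd =>
    Real.abs_le_sqrt (h _ hM c hc d hd hcd)
  have hle : sSup X ≤ √(K * sSup X) := by
    refine csSup_le ⟨_, c, hc, d, hd, rfl⟩ ?_
    rintro _ ⟨c, hc, d, hd, rfl⟩
    exact hall c hc d hd
  have hsq : sSup X ^ 2 ≤ K * sSup X :=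
    (Real.le_sqrt hM0 (mul_nonneg hK0 hM0)).1 hle
  refine (hM c hc d hd).trans ?_
  rcases hM0.eq_or_lt with h | h
  · rwa [← h]
  · rw [pow_two] at hsq
    exact le_of_mul_le_mul_right hsq h

theorem weightedCycle_sq_le_abs_mul {r : ℕ} (hn : n = 2 * r) (hr : 2 ≤ r)
    (hU : IsUnitBounded U) {M : ℝ}
    (hM : ∀ c : Fin n → Bool, (∀ i, c (i + 1) = !c i) → ∀ d : Fin n → Ω → ℝ,
      (∀ i, IsUnitBounded (d i)) → |weightedCycle U c d| ≤ M)
    {c : Fin n → Bool} (hc : ∀ i, c (i + 1) = !c i) {d : Fin n → Ω → ℝ}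
    (hd : ∀ i, IsUnitBounded (d i)) :
    weightedCycle U c d ^ 2 ≤ |weightedCycle U c (reflectWeights r d)| * M := by
  have h1 := cycle_reflection_sq_le hn hr hU hc hd (s := fun _ => 1) .one
    ((dependsOn_const (1 : ℝ)).mono (Set.empty_subset _))
  simp only [one_mul] at h1
  refine h1.trans ((le_abs_self _).trans ?_)
  rw [abs_mul]
  exact mul_le_mul_of_nonneg_left
    (hM c hc _ (isUnitBounded_reflectWeights r fun i => hd (-i))) (abs_nonneg _)

/-- The weights at the nodes `1, …, k` can be removed without decreasing the supremum of the
absolute value of the density of a weighted cycle. -/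
theorem abs_weightedCycle_le_of_forall_run {r : ℕ} (hn : n = 2 * r) (hr : 2 ≤ r)
    (hU : IsUnitBounded U) {K : ℝ} (k : ℕ) (hk : k < r)
    (hK : ∀ c : Fin n → Bool, (∀ i, c (i + 1) = !c i) → ∀ d : Fin n → Ω → ℝ,
      (∀ i, IsUnitBounded (d i)) → (∀ i, 1 ≤ i.val → i.val ≤ k → d i = fun _ => 1) →
      |weightedCycle U c d| ≤ K)
    (c : Fin n → Bool) (hc : ∀ i, c (i + 1) = !c i) (d : Fin n → Ω → ℝ)
    (hd : ∀ i, IsUnitBounded (d i)) : |weightedCycle U c d| ≤ K := by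
  induction k generalizing K c d with
  | zero => exact hK c hc d hd fun i h1 h2 => by omega
  | succ k ih =>
    have hn2 : 2 ≤ n := by omega
    have hK0 : 0 ≤ K := (abs_nonneg _).trans
      (hK c hc (fun _ _ => 1) (fun _ => .one) fun _ _ _ => rfl)
    refine abs_weightedCycle_le_of_sq_le hU
      (fun _ d => ∀ i : Fin n, 1 ≤ i.val → i.val ≤ k → d i = fun _ => 1) hK0 ?_ ?_ c hc d hd
    · intro K' hK' c hc d hd
      exact ih (by omega) hK' c hc d hd
    · intro M hM c hc d hd hrun
      have hM0 : 0 ≤ M := (abs_nonneg _).trans (hM c hc d hd)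
      refine (weightedCycle_sq_le_abs_mul hn hr hU hM hc hd).trans
        (mul_le_mul_of_nonneg_right ?_ hM0)
      have hrefl := isUnitBounded_reflectWeights r hd
      -- Reflection trivialises node 0 and keeps the run 1, …, k; the run 0, …, k is then rotated to
      -- 1, …, k + 1.
      have hrot := weightedCycle_rotate hU (fun i => c (i - 1))
        (d := fun i => reflectWeights r d (i - 1)) fun i => hrefl _
      simp only [add_sub_cancel_right] at hrot
      rw [hrot]
      refine hK _ (fun i => ?_) _ (fun i => hrefl _) fun i h1 h2 => ?_
      · rw [← hc, sub_add_cancel, add_sub_cancel_right]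
      · have h3 := Fin.val_add_one_eq_ite hn2 (i - 1)
        rw [sub_add_cancel] at h3
        have h4 : (i - 1).val ≤ k := by split_ifs at h3 <;> omega
        rw [reflectWeights]
        split_ifs with h5 h6
        · exact hrun _ h5.1 h4
        · omega
        · rfl

/-- There are only two alternating colourings, and a rotation by one step exchanges them. -/
theorem weightedCycle_one_eq (hU : IsUnitBounded U) {c c' : Fin n → Bool}
    (hc : ∀ i, c (i + 1) = !c i) (hc' : ∀ i, c' (i + 1) = !c' i) :
    weightedCycle U c (fun _ _ => 1) = weightedCycle U c' fun _ _ => 1 := by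
  have key : ∀ {c c' : Fin n → Bool}, (∀ i, c (i + 1) = !c i) → (∀ i, c' (i + 1) = !c' i) →
      c 0 = c' 0 → c = c' := by
    intro c c' hc hc' h0
    have h : ∀ k : ℕ, c (Fin.ofNat n k) = c' (Fin.ofNat n k) := by
      intro k
      induction k with
      | zero => exact h0
      | succ k ih =>
        have e : Fin.ofNat n (k + 1) = Fin.ofNat n k + 1 := by
          ext; simp [Fin.val_add]
        rw [e, hc, hc', ih]
    funext i
    simpa using h i.val
  by_cases h0 : c 0 = c' 0
  · rw [key hc hc' h0]
  · rw [← weightedCycle_rotate hU c' (d := fun _ _ => 1) fun _ => .one]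
    rw [key (c' := fun i => c' (i + 1)) hc (fun i => by rw [hc' (i + 1)])
      (by rw [hc']; cases h : c 0 <;> cases h' : c' 0 <;> simp_all)]

theorem weightedCycle_one_nonneg {r : ℕ} (hn : n = 2 * r) (hr : 2 ≤ r)
    (hU : IsUnitBounded U) {c : Fin n → Bool} (hc : ∀ i, c (i + 1) = !c i) :
    0 ≤ weightedCycle U c fun _ _ => 1 := by
  classical
  have h1 := isUnitBounded_halfCycle hU c r (d := fun _ _ => 1) fun _ => .one
  rw [← reflectWeights_eq_one (n := n) hn fun _ _ _ => rfl, weightedCycle]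
  simp only [← halfCycle_mul_halfCycle_neg hn hr hc]
  refine (integral_mul_comp_reflection (τ := Equiv.neg (Fin n))
    (S := {i : Fin n | i.val = 0 ∨ i.val = r}) (L := {i : Fin n | 0 < i.val ∧ i.val < r})
    (R := {i : Fin n | r < i.val}) ?_ ?_ ?_ h1 ?_).symm ▸
    integral_nonneg fun _ => sq_nonneg _
  · intro i hi
    ext
    simp only [Set.mem_ofPred_eq, Equiv.neg_apply, Fin.val_neg_eq_ite] at hi ⊢
    split_ifs <;> omega
  · intro i hi
    simp only [Set.mem_ofPred_eq, Equiv.neg_apply, Fin.val_neg_eq_ite] at hi ⊢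
    split_ifs <;> omega
  · rw [Set.disjoint_left]
    intro i hi hi'
    simp only [Set.mem_ofPred_eq] at hi hi'
    omega
  · refine (dependsOn_halfCycle c hn hr _).mono fun i hi => ?_
    simp only [Set.mem_ofPred_eq, Set.mem_union] at hi ⊢
    omega

theorem abs_weightedCycle_le {r : ℕ} (hn : n = 2 * r) (hr : 2 ≤ r)
    (hU : IsUnitBounded U) {c c' : Fin n → Bool} (hc : ∀ i, c (i + 1) = !c i)
    (hc' : ∀ i, c' (i + 1) = !c' i) {d : Fin n → Ω → ℝ}
    (hd : ∀ i, IsUnitBounded (d i)) :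
    |weightedCycle U c d| ≤ weightedCycle U c' fun _ _ => 1 := by
  -- When the nodes 1, …, r - 1 have trivial weights, one more reflection makes all weights trivial,
  -- so K can be the density of the plain cycle.
  refine abs_weightedCycle_le_of_sq_le hU
    (fun _ d => ∀ i : Fin n, 1 ≤ i.val → i.val ≤ r - 1 → d i = fun _ => 1)
    (weightedCycle_one_nonneg hn hr hU hc') ?_ ?_ c hc d hd
  · intro K' hK' c hc d hd
    exact abs_weightedCycle_le_of_forall_run hn hr hU (r - 1) (by omega) hK' c hc d hd
  · intro M hM c hc d hd hrun
    have h := weightedCycle_sq_le_abs_mul hn hr hU hM hc hd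
    rwa [reflectWeights_eq_one hn hrun, weightedCycle_one_eq hU hc hc',
      abs_of_nonneg (weightedCycle_one_nonneg hn hr hU hc')] at h

/-- A cycle with weights at its nodes and a further bounded factor that depends on two antipodal
nodes only. -/
theorem abs_integral_antipodal_cycle_le {r : ℕ} (hn : n = 2 * r) (hr : 2 ≤ r)
    (hU : IsUnitBounded U) {c c' : Fin n → Bool} (hc : ∀ i, c (i + 1) = !c i)
    (hc' : ∀ i, c' (i + 1) = !c' i) {d : Fin n → Ω → ℝ}
    (hd : ∀ i, IsUnitBounded (d i)) {s : (Fin n → Ω) → ℝ} (hs : IsUnitBounded s)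
    (hsd : DependsOn s {i | i.val = 0 ∨ i.val = r}) :
    |∫ y, s y * ((∏ i, d i (y i)) * ∏ i, cycleFactor U c i y)| ≤
      weightedCycle U c' fun _ _ => 1 := by
  have h0 := weightedCycle_one_nonneg hn hr hU hc'
  refine abs_le_of_sq_le_sq ?_ h0
  refine (cycle_reflection_sq_le hn hr hU hc hd hs hsd).trans ((le_abs_self _).trans ?_)
  rw [abs_mul, pow_two]
  exact mul_le_mul
    (abs_weightedCycle_le hn hr hU hc hc' (isUnitBounded_reflectWeights r hd))
    (abs_weightedCycle_le hn hr hU hc hc' (isUnitBounded_reflectWeights r fun i => hd (-i)))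
    (abs_nonneg _) h0

end CycleDensity

/-! ### Products over edges as functions of a few coordinates. -/

section EdgeProducts

variable {V κ Ω : Type*}

/-- The product of `U` over a finite set of ordered pairs of nodes. -/
def edgeProd (U : Ω × Ω → ℝ) (E : Finset (V × V)) (x : V → Ω) : ℝ :=
  ∏ e ∈ E, U (x e.1, x e.2)

theorem isUnitBounded_edgeProd [MeasurableSpace Ω] {U : Ω × Ω → ℝ} (hU : IsUnitBounded U)
    (E : Finset (V × V)) : IsUnitBounded (edgeProd U E) :=
  .prod _ fun _ _ => hU.comp (by fun_prop)

open Classical in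
/-- If no edge has both endpoints in the range of `i`, then, as a function of the coordinates in
that range, the product over the edges is a product of weights of single nodes. -/
theorem exists_edgeProd_extend_eq [MeasurableSpace Ω] {U : Ω × Ω → ℝ} (hU : IsUnitBounded U)
    [Fintype κ] [Nonempty κ] {i : κ → V} (hi : i.Injective) {E : Finset (V × V)}
    (hE : ∀ e ∈ E, e.1 ∈ Set.range i → e.2 ∉ Set.range i) (x : V → Ω) :
    ∃ d : κ → Ω → ℝ, (∀ k, IsUnitBounded (d k)) ∧
      ∀ y : κ → Ω, edgeProd U E (Function.extend i y x) = ∏ k, d k (y k) := by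
  have h : ∀ e ∈ E, ∃ k : κ, ∃ φ : Ω → ℝ, IsUnitBounded φ ∧ ∀ y : κ → Ω,
      U (Function.extend i y x e.1, Function.extend i y x e.2) = φ (y k) := by
    intro e he
    by_cases h1 : e.1 ∈ Set.range i
    · obtain ⟨k, hk⟩ := h1
      refine ⟨k, fun a => U (a, x e.2), hU.comp (by fun_prop), fun y => ?_⟩
      rw [Function.extend_apply' _ _ e.2 (hE e he ⟨k, hk⟩), ← hk, hi.extend_apply]
    · by_cases h2 : e.2 ∈ Set.range i
      · obtain ⟨k, hk⟩ := h2
        refine ⟨k, fun a => U (x e.1, a), hU.comp (by fun_prop), fun y => ?_⟩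
        rw [Function.extend_apply' _ _ e.1 h1, ← hk, hi.extend_apply]
      -- An edge that misses the range is a constant factor, charged to an arbitrary node.
      · refine ⟨Classical.arbitrary κ, fun _ => U (x e.1, x e.2), .const (hU.bound _),
          fun y => ?_⟩
        rw [Function.extend_apply' _ _ e.1 h1, Function.extend_apply' _ _ e.2 h2]
  choose! k φ hφ hy using h
  refine ⟨fun j a => ∏ e ∈ E with k e = j, φ e a, fun j => .prod _ fun e he =>
    hφ e (Finset.mem_filter.1 he).1, fun y => ?_⟩
  rw [edgeProd, ← Finset.prod_fiberwise E k]
  refine Finset.prod_congr rfl fun j _ => Finset.prod_congr rfl fun e he => ?_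
  rw [Finset.mem_filter] at he
  rw [hy e he.1, he.2]

end EdgeProducts

/-! ### An induced cycle inside a graph. -/

section CycleInGraph

variable {V Ω : Type*} {n : ℕ} [NeZero n]

/-- The edge of a cycle between the nodes with the numbers `k` and `k + 1`, as an ordered pair. -/
def cycleEdge (i : Fin n → V) (c : Fin n → Bool) (k : Fin n) : V × V :=
  if c k then (i k, i (k + 1)) else (i (k + 1), i k)

theorem cycleEdge_injective (hn : 3 ≤ n) {i : Fin n → V} (hi : i.Injective) (c : Fin n → Bool) :
    (cycleEdge i c).Injective := by
  -- Two numbers that are successors of each other would force n ≤ 2; a cycle with two nodes would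
  -- repeat its edge.
  have key : ∀ k k' : Fin n, k = k' + 1 → k' = k + 1 → False := by
    intro k k' h1 h2
    have e1 := Fin.val_add_one_eq_ite (by omega) k
    have e2 := Fin.val_add_one_eq_ite (by omega) k'
    rw [← h2] at e1
    rw [← h1] at e2
    split_ifs at e1 e2 <;> omega
  intro k k' h
  unfold cycleEdge at h
  split_ifs at h
  · exact hi (Prod.ext_iff.1 h).1
  · exact (key _ _ (hi (Prod.ext_iff.1 h).1) (hi (Prod.ext_iff.1 h).2).symm).elim
  · exact (key _ _ (hi (Prod.ext_iff.1 h).2) (hi (Prod.ext_iff.1 h).1).symm).elim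
  · exact hi (Prod.ext_iff.1 h).2

theorem cycleEdge_extend (U : Ω × Ω → ℝ) {i : Fin n → V} (hi : i.Injective) (c : Fin n → Bool)
    (k : Fin n) (x : V → Ω) (y : Fin n → Ω) :
    U (Function.extend i y x (cycleEdge i c k).1, Function.extend i y x (cycleEdge i c k).2) =
      cycleFactor U c k y := by
  unfold cycleEdge cycleFactor
  split_ifs <;> simp only [hi.extend_apply]

variable [Fintype V] [MeasureSpace Ω] [IsProbabilityMeasure (volume : Measure Ω)]

open Classical in
/-- If `E` contains an induced cycle of length `2r`, then the density of `E`, with a further factor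
that depends on at most two antipodal nodes of the cycle, is bounded by the density of the
cycle. -/
theorem abs_integral_mul_edgeProd_le {r : ℕ} (hn : n = 2 * r) (hr : 2 ≤ r) {U : Ω × Ω → ℝ}
    (hU : IsUnitBounded U) {c c' : Fin n → Bool} (hc : ∀ i, c (i + 1) = !c i)
    (hc' : ∀ i, c' (i + 1) = !c' i) {i : Fin n → V} (hi : i.Injective) {E : Finset (V × V)}
    (hcE : ∀ k, cycleEdge i c k ∈ E)
    (hE : ∀ e ∈ E, e.1 ∈ Set.range i → e.2 ∈ Set.range i → ∃ k, e = cycleEdge i c k)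
    {s : (V → Ω) → ℝ} (hs : IsUnitBounded s) {N : Set V} (hsN : DependsOn s N)
    (hN : ∀ k, i k ∈ N → k.val = 0 ∨ k.val = r) :
    |∫ x, s x * edgeProd U E x| ≤ weightedCycle U c' fun _ _ => 1 := by
  have hm := fun x : V → Ω => (measurable_extend (Ω := Ω) i).comp (measurable_prodMk_left (x := x))
  rw [← integral_extend hi (hs.mul (isUnitBounded_edgeProd hU E))]
  set C : Finset (V × V) := Finset.univ.image (cycleEdge i c) with hC
  have hCE : C ⊆ E := by
    intro e he
    obtain ⟨k, -, rfl⟩ := Finset.mem_image.1 he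
    exact hcE k
  have hinner : ∀ x : V → Ω, ‖∫ y : Fin n → Ω, s (Function.extend i y x) *
      edgeProd U E (Function.extend i y x)‖ ≤ weightedCycle U c' fun _ _ => 1 := by
    intro x
    -- As the cycle is induced, an edge outside C has at most one endpoint on it, so for fixed x
    -- these edges become weights.
    obtain ⟨d, hd, hdy⟩ := exists_edgeProd_extend_eq hU hi (E := E \ C) (fun e he h1 h2 => by
      rw [Finset.mem_sdiff] at he
      obtain ⟨k, rfl⟩ := hE e he.1 h1 h2
      exact he.2 (Finset.mem_image_of_mem _ (Finset.mem_univ _))) x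
    have e1 : ∀ y : Fin n → Ω, edgeProd U E (Function.extend i y x) =
        (∏ k, d k (y k)) * ∏ k, cycleFactor U c k y := by
      intro y
      rw [← hdy, edgeProd, ← Finset.prod_sdiff hCE, edgeProd]
      congr 1
      rw [hC, Finset.prod_image fun k _ k' _ h => cycleEdge_injective (by omega) hi c h]
      exact Finset.prod_congr rfl fun k _ => cycleEdge_extend U hi c k x y
    simp only [e1]
    refine abs_integral_antipodal_cycle_le hn hr hU hc hc' hd (hs.comp (hm x)) ?_
    intro y y' h
    refine hsN fun v hv => ?_
    by_cases hvi : v ∈ Set.range i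
    · obtain ⟨k, rfl⟩ := hvi
      change Function.extend i y x (i k) = Function.extend i y' x (i k)
      rw [hi.extend_apply, hi.extend_apply]
      exact h k (hN k hv)
    · exact (Function.extend_apply' _ _ _ hvi).trans (Function.extend_apply' _ _ _ hvi).symm
  have := norm_integral_le_of_norm_le_const (μ := (volume : Measure (V → Ω))) (.of_forall hinner)
  simpa using this

end CycleInGraph

/-! ### Densities of unweighted even cycles. -/

section EvenCycle

theorem SimpleGraph.cycleGraph_adj_iff_add_one {n : ℕ} [NeZero n] (hn : 2 ≤ n) {u v : Fin n} :
    (SimpleGraph.cycleGraph n).Adj u v ↔ u = v + 1 ∨ v = u + 1 := by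
  obtain ⟨m, rfl⟩ : ∃ m, n = m + 2 := ⟨n - 2, by omega⟩
  rw [SimpleGraph.cycleGraph_adj, sub_eq_iff_eq_add, sub_eq_iff_eq_add, add_comm 1 v, add_comm 1 u]

variable {n : ℕ} [NeZero n]

/-- The colouring of the nodes `0, …, n - 1` by parity. -/
def parityColor (n : ℕ) (i : Fin n) : Bool := decide (i.val % 2 = 0)

theorem parityColor_add_one {r : ℕ} (hn : n = 2 * r) (hr : 2 ≤ r) (i : Fin n) :
    parityColor n (i + 1) = !parityColor n i := by
  unfold parityColor
  rw [Fin.val_add_one_eq_ite (by omega)]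
  rw [← decide_not, decide_eq_decide]
  split_ifs <;> omega

theorem bigraphDensity_cycleGraph {r : ℕ} (hn : n = 2 * r) (hr : 2 ≤ r)
    (c : (SimpleGraph.cycleGraph n).Coloring Bool) (U : I × I → ℝ) :
    bigraphDensity (SimpleGraph.cycleGraph n) c U = weightedCycle U c fun _ _ => 1 := by
  have hadj : ∀ i : Fin n, (SimpleGraph.cycleGraph n).Adj i (i + 1) := fun i =>
    (SimpleGraph.cycleGraph_adj_iff_add_one (by omega)).2 (.inr rfl)
  rw [bigraphDensity, weightedCycle]
  congr 1; ext y
  rw [Finset.prod_const_one, one_mul]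
  symm
  refine Finset.prod_bij (fun k _ => cycleEdge id c k) ?_ ?_ ?_ ?_
  · intro k _
    have h1 := c.valid (hadj k)
    simp only [Finset.mem_filter, Finset.mem_univ, true_and, cycleEdge]
    split_ifs with h
    · exact ⟨hadj k, h⟩
    · refine ⟨(hadj k).symm, ?_⟩
      simp only [id]
      cases h2 : c (k + 1) <;> simp_all
  · intro k _ k' _ h
    exact cycleEdge_injective (by omega) Function.injective_id _ h
  · rintro ⟨u, v⟩ he
    simp only [Finset.mem_filter, Finset.mem_univ, true_and] at he
    obtain ⟨huv, hu⟩ := he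
    have h1 := c.valid huv
    rcases (SimpleGraph.cycleGraph_adj_iff_add_one (by omega)).1 huv with rfl | rfl
    · exact ⟨v, Finset.mem_univ _, by
        have hv : ¬ c v = true := fun h => h1 (by rw [hu, h])
        simp only [cycleEdge, if_neg hv, id]⟩
    · exact ⟨u, Finset.mem_univ _, by simp only [cycleEdge, if_pos hu, id]⟩
  · intro k _
    simp only [cycleEdge, cycleFactor, id]
    split_ifs <;> rfl

theorem evenCycleDensity_eq {r : ℕ} [NeZero (2 * r)] (hr : 2 ≤ r) (U : I × I → ℝ) :
    evenCycleDensity r U = weightedCycle U (parityColor (2 * r)) fun _ _ => 1 :=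
  bigraphDensity_cycleGraph rfl hr _ U

/-- For fixed nodes 0 and 2, the integrals over nodes 1 and 3 separate, and each is the codegree. -/
theorem weightedCycle_four_eq {Ω : Type*} [MeasureSpace Ω]
    [IsProbabilityMeasure (volume : Measure Ω)] {U : Ω × Ω → ℝ} (hU : IsUnitBounded U) :
    weightedCycle U (parityColor 4) (fun _ _ => 1) = codegreeSq U := by
  have hb := isUnitBounded_weightedCycle_integrand hU (parityColor 4) (d := fun _ _ => 1)
    fun _ => .one
  rw [weightedCycle, integral_fin_four hb, codegreeSq]
  have hc := isUnitBounded_codegree hU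
  refine Eq.trans ?_ (integral_prod _ (hc.sq.integrable (volume.prod volume))).symm
  congr 1; ext a
  have hbc : IsUnitBounded (fun p : Ω × Ω =>
      U (a, p.1) * U (p.2, p.1) * ∫ d, U (p.2, d) * U (a, d)) :=
    ((hU.comp (by fun_prop)).mul (hU.comp (by fun_prop))).mul
      (hc.comp (h := fun p : Ω × Ω => (p.2, a)) (by fun_prop))
  have e : ∀ b c d : Ω, ∏ i, cycleFactor U (parityColor 4) i ![a, b, c, d] =
      U (a, b) * U (c, b) * (U (c, d) * U (a, d)) := by
    intro b c d
    simp [Fin.prod_univ_four, cycleFactor, parityColor]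
    ring
  simp only [Finset.prod_const_one, one_mul, e, integral_const_mul]
  refine (integral_integral_swap (hbc.integrable (volume.prod volume))).trans ?_
  congr 1; ext c
  rw [integral_mul_const, pow_two]
  congr 2
  ext d; ring

theorem evenCycleDensity_two_eq {U : I × I → ℝ} (hU : IsUnitBounded U) :
    evenCycleDensity 2 U = codegreeSq U :=
  (evenCycleDensity_eq le_rfl U).trans (weightedCycle_four_eq hU)

end EvenCycle

/-! ### Integrating out the coordinates of some nodes. -/

section Marginals

variable {V κ Ω : Type*}

theorem edgeProd_extend_of_forall_notMem (U : Ω × Ω → ℝ) {i : κ → V} {E : Finset (V × V)}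
    (hE : ∀ e ∈ E, e.1 ∉ Set.range i ∧ e.2 ∉ Set.range i) (x : V → Ω) (y : κ → Ω) :
    edgeProd U E (Function.extend i y x) = edgeProd U E x := by
  refine Finset.prod_congr rfl fun e he => ?_
  rw [Function.extend_apply' _ _ _ (hE e he).1, Function.extend_apply' _ _ _ (hE e he).2]

variable [Fintype κ] [MeasureSpace Ω]

/-- The integral of an edge product over the coordinates in the range of `i`. -/
noncomputable def edgeMarginal (U : Ω × Ω → ℝ) (i : κ → V) (H : Finset (V × V)) (x : V → Ω) : ℝ :=
  ∫ y : κ → Ω, edgeProd U H (Function.extend i y x)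

theorem dependsOn_edgeMarginal (U : Ω × Ω → ℝ) {i : κ → V} (hi : i.Injective)
    (H : Finset (V × V)) :
    DependsOn (edgeMarginal U i H) {v | v ∉ Set.range i ∧ ∃ e ∈ H, e.1 = v ∨ e.2 = v} := by
  intro x x' h
  have key : ∀ (y : κ → Ω) (v : V), (∃ e ∈ H, e.1 = v ∨ e.2 = v) →
      Function.extend i y x v = Function.extend i y x' v := by
    intro y v hv
    by_cases hvi : v ∈ Set.range i
    · obtain ⟨k, rfl⟩ := hvi
      rw [hi.extend_apply, hi.extend_apply]
    · rw [Function.extend_apply' _ _ _ hvi, Function.extend_apply' _ _ _ hvi]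
      exact h v ⟨hvi, hv⟩
  unfold edgeMarginal
  congr 1; ext y
  refine Finset.prod_congr rfl fun e he => ?_
  rw [key y e.1 ⟨e, he, .inl rfl⟩, key y e.2 ⟨e, he, .inr rfl⟩]

variable [IsProbabilityMeasure (volume : Measure Ω)] {U : Ω × Ω → ℝ}

theorem isUnitBounded_edgeMarginal (hU : IsUnitBounded U) (i : κ → V) (H : Finset (V × V)) :
    IsUnitBounded (edgeMarginal U i H) :=
  ((isUnitBounded_edgeProd hU H).comp (measurable_extend i)).integral_right volume

theorem integral_edgeProd_union [Fintype V] [DecidableEq V] (hU : IsUnitBounded U) {i : κ → V}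
    (hi : i.Injective) {E H : Finset (V × V)} (hH : H ⊆ E)
    (hE : ∀ e ∈ E \ H, e.1 ∉ Set.range i ∧ e.2 ∉ Set.range i) :
    ∫ x, edgeProd U E x = ∫ x, edgeMarginal U i H x * edgeProd U (E \ H) x := by
  rw [← integral_extend hi (isUnitBounded_edgeProd hU E)]
  congr 1; ext x
  rw [edgeMarginal, ← integral_mul_const]
  congr 1; ext y
  rw [← edgeProd_extend_of_forall_notMem U hE x y]
  unfold edgeProd
  rw [mul_comm, Finset.prod_sdiff hH]

end Marginals

/-! ### An edge that avoids the cycle: the estimate for girth at least 6. -/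

section GirthAtLeastSix

variable {V Ω : Type*} {n : ℕ} [NeZero n] [Fintype V] [MeasureSpace Ω]
  [IsProbabilityMeasure (volume : Measure Ω)] {U : Ω × Ω → ℝ}

theorem abs_integral_mul_edgeProd_le_mul {r : ℕ} (hn : n = 2 * r) (hr : 2 ≤ r)
    (hU : IsUnitBounded U) {c c' : Fin n → Bool} (hc : ∀ i, c (i + 1) = !c i)
    (hc' : ∀ i, c' (i + 1) = !c' i) {i : Fin n → V} (hi : i.Injective) {E : Finset (V × V)}
    (hcE : ∀ k, cycleEdge i c k ∈ E)
    (hE : ∀ e ∈ E, e.1 ∈ Set.range i → e.2 ∈ Set.range i → ∃ k, e = cycleEdge i c k)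
    {s : (V → Ω) → ℝ} (hs : Measurable s) {κ : ℝ} (hκ : 0 ≤ κ) (hsκ : ∀ x, |s x| ≤ κ) {N : Set V}
    (hsN : DependsOn s N) (hN : ∀ k, i k ∈ N → k.val = 0 ∨ k.val = r) :
    |∫ x, s x * edgeProd U E x| ≤ κ * weightedCycle U c' fun _ _ => 1 := by
  -- For κ > 0 the factor s is normalised to κ⁻¹ s; κ = 0 makes it vanish.
  rcases hκ.eq_or_lt with rfl | h
  · have h0 : ∀ x, s x = 0 := fun x => abs_eq_zero.1 (le_antisymm (hsκ x) (abs_nonneg _))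
    simp [h0]
  · have e : ∀ x, s x * edgeProd U E x = κ * ((κ⁻¹ * s x) * edgeProd U E x) := by
      intro x; field_simp
    simp only [e]
    rw [integral_const_mul, abs_mul, abs_of_pos h]
    refine mul_le_mul_of_nonneg_left ?_ h.le
    refine abs_integral_mul_edgeProd_le hn hr hU hc hc' hi hcE hE
      ⟨hs.const_mul _, fun x => ?_⟩ (N := N) (fun x y hxy => ?_) hN
    · rw [abs_mul, abs_inv, abs_of_pos h, inv_mul_le_iff₀ h, mul_one]
      exact hsκ x
    · simp only [hsN hxy]

open Classical in
/-- A graph with an induced cycle of length `2r` and an edge outside of it whose endpoints are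
joined to at most two antipodal nodes of the cycle. -/
theorem abs_integral_edgeProd_le_of_outer_edge {r : ℕ} (hn : n = 2 * r) (hr : 2 ≤ r)
    (hU : IsUnitBounded U) {c c' : Fin n → Bool} (hc : ∀ i, c (i + 1) = !c i)
    (hc' : ∀ i, c' (i + 1) = !c' i) {i : Fin n → V} (hi : i.Injective) {E : Finset (V × V)}
    (hcE : ∀ k, cycleEdge i c k ∈ E)
    (hE : ∀ e ∈ E, e.1 ∈ Set.range i → e.2 ∈ Set.range i → ∃ k, e = cycleEdge i c k)
    {χ : V → Bool} (hχ : ∀ e ∈ E, χ e.1 = true ∧ χ e.2 = false)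
    {w z : V} (hwz : (w, z) ∈ E) (hw : w ∉ Set.range i) (hz : z ∉ Set.range i)
    (hN : ∀ k, (w, i k) ∈ E ∨ (i k, z) ∈ E → k.val = 0 ∨ k.val = r) :
    |∫ x : V → Ω, edgeProd U E x| ≤ √√(codegreeSq U) * weightedCycle U c' fun _ _ => 1 := by
  have hχwz := hχ _ hwz
  have hne : w ≠ z := by rintro rfl; simp_all
  set j : Fin 2 → V := ![w, z] with hj
  have hji : j.Injective := by
    intro a b hab
    fin_cases a <;> fin_cases b <;> simp_all
  have hjr : ∀ v, v ∈ Set.range j ↔ v = w ∨ v = z := by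
    intro v
    simp [hj, eq_comm, or_comm]
  set H : Finset (V × V) := {e ∈ E | e.1 = w ∨ e.2 = z} with hH
  have hHE : H ⊆ E := Finset.filter_subset _ _
  have hEH : ∀ e ∈ E \ H, e.1 ∉ Set.range j ∧ e.2 ∉ Set.range j := by
    intro e he
    simp only [hH, Finset.mem_sdiff, Finset.mem_filter, not_and, not_or] at he
    have h1 := hχ e he.1
    have h2 := he.2 he.1
    rw [hjr, hjr]
    refine ⟨?_, ?_⟩
    · rintro (h | h)
      · exact h2.1 h
      · rw [h] at h1; simp_all
    · rintro (h | h)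
      · rw [h] at h1; simp_all
      · exact h2.2 h
  rw [integral_edgeProd_union hU hji hHE hEH]
  have hcw : ∀ k, (cycleEdge i c k).1 ∈ Set.range i ∧ (cycleEdge i c k).2 ∈ Set.range i := by
    intro k
    unfold cycleEdge
    split_ifs <;> exact ⟨Set.mem_range_self _, Set.mem_range_self _⟩
  refine abs_integral_mul_edgeProd_le_mul hn hr hU hc hc' hi (fun k => ?_)
    (fun e he => hE e (Finset.mem_sdiff.1 he).1) (isUnitBounded_edgeMarginal hU j H).meas
    (Real.sqrt_nonneg _) ?_
    (dependsOn_edgeMarginal U hji H) ?_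
  · rw [Finset.mem_sdiff, hH, Finset.mem_filter]
    refine ⟨hcE k, fun h => ?_⟩
    rcases h.2 with h | h
    · exact hw (h ▸ (hcw k).1)
    · exact hz (h ▸ (hcw k).2)
  · intro x
    have hwzH : {(w, z)} ⊆ H := by
      rw [Finset.singleton_subset_iff, hH, Finset.mem_filter]
      exact ⟨hwz, .inl rfl⟩
    -- By the colouring, (w, z) is the only edge inside {w, z}; all other edges of H are weights at
    -- w or z.
    obtain ⟨d, hd, hdy⟩ := exists_edgeProd_extend_eq hU hji (E := H \ {(w, z)}) (by
      intro e he h1 h2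
      rw [Finset.mem_sdiff, Finset.mem_singleton] at he
      have h3 := hχ e (hHE he.1)
      rw [hjr] at h1 h2
      refine he.2 (Prod.ext ?_ ?_)
      · rcases h1 with h | h
        · exact h
        · rw [h] at h3; simp_all
      · rcases h2 with h | h
        · rw [h] at h3; simp_all
        · exact h) x
    have e1 : ∀ y : Fin 2 → Ω, edgeProd U H (Function.extend j y x) =
        U (y 0, y 1) * (d 0 (y 0) * d 1 (y 1)) := by
      intro y
      rw [edgeProd, ← Finset.prod_sdiff hwzH, Finset.prod_singleton, mul_comm]
      have h0 : Function.extend j y x w = y 0 := hji.extend_apply y x 0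
      have h1 : Function.extend j y x z = y 1 := hji.extend_apply y x 1
      simp only [h0, h1]
      congr 1
      exact (hdy y).trans (Fin.prod_univ_two _)
    unfold edgeMarginal
    simp only [e1]
    rw [integral_fin_two ((hU.comp (by fun_prop)).mul
      (((hd 0).comp (by fun_prop)).mul ((hd 1).comp (by fun_prop))))]
    exact abs_integral_edge_le hU (hd 0) (hd 1)
  · rintro k ⟨-, e, he, hk⟩
    rw [hH, Finset.mem_filter] at he
    refine hN k ?_
    obtain ⟨e1, e2⟩ := e
    have hwi : w ≠ i k := fun h => hw ⟨k, h.symm⟩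
    have hzi : z ≠ i k := fun h => hz ⟨k, h.symm⟩
    simp only at he hk
    rcases he with ⟨he, rfl | rfl⟩
    · rcases hk with hk | hk
      · exact absurd hk hwi
      · left; rwa [← hk]
    · rcases hk with hk | hk
      · right; rwa [← hk]
      · exact absurd hk hzi

end GirthAtLeastSix

/-! ### A non-adjacent pair of nodes: the estimate for girth 4. -/

section GirthFour

variable {V Ω : Type*} [MeasureSpace Ω]
  [IsProbabilityMeasure (volume : Measure Ω)] {U : Ω × Ω → ℝ}

/-- The integral over the variable of a node of the product over the edges that start there. -/
noncomputable def starMarginal (U : Ω × Ω → ℝ) (S : Finset (V × V)) (x : V → Ω) : ℝ :=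
  ∫ a, ∏ e ∈ S, U (a, x e.2)

theorem isUnitBounded_starMarginal (hU : IsUnitBounded U) (S : Finset (V × V)) :
    IsUnitBounded (starMarginal U S : (V → Ω) → ℝ) :=
  IsUnitBounded.integral_right (f := fun p : (V → Ω) × Ω => ∏ e ∈ S, U (p.2, p.1 e.2))
    (.prod _ fun _ _ => hU.comp (by fun_prop)) volume

-- Since p and q lie in the same class, the only edges inside {b, p, q} are the two edges of the
-- path, and all others become weights.
open Classical in
theorem abs_integral_edgeProd_le_of_path (hU : IsUnitBounded U) {E : Finset (V × V)}
    {χ : V → Bool} (hχ : ∀ e ∈ E, χ e.1 = true ∧ χ e.2 = false) {p q b : V} (hpq : p ≠ q)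
    (hp : (p, b) ∈ E) (hq : (q, b) ∈ E) (x : V → Ω) :
    |∫ y : Fin 3 → Ω, edgeProd U E (Function.extend ![b, p, q] y x)| ≤ √(codegreeSq U) := by
  have hbp : b ≠ p := by
    rintro rfl; have := hχ _ hp; simp_all
  have hbq : b ≠ q := by
    rintro rfl; have := hχ _ hq; simp_all
  set j : Fin 3 → V := ![b, p, q] with hj
  have hji : j.Injective := by
    intro a b hab
    fin_cases a <;> fin_cases b <;> simp_all
  have hjr : ∀ v, v ∈ Set.range j ↔ v = b ∨ v = p ∨ v = q := by
    intro v
    constructor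
    · rintro ⟨k, rfl⟩
      fin_cases k <;> simp [hj]
    · rintro (rfl | rfl | rfl)
      · exact ⟨0, rfl⟩
      · exact ⟨1, rfl⟩
      · exact ⟨2, rfl⟩
  set T : Finset (V × V) := {(p, b), (q, b)} with hT
  have hTE : T ⊆ E := by
    intro e he
    rw [hT, Finset.mem_insert, Finset.mem_singleton] at he
    rcases he with rfl | rfl <;> assumption
  obtain ⟨d, hd, hdy⟩ := exists_edgeProd_extend_eq hU hji (E := E \ T) (by
    rintro ⟨u, v⟩ he h1 h2
    rw [Finset.mem_sdiff, hT, Finset.mem_insert, Finset.mem_singleton, not_or] at he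
    have h3 := hχ _ he.1
    have hp3 := hχ _ hp
    have hq3 := hχ _ hq
    rw [hjr] at h1 h2
    simp only at h1 h2 h3 hp3 hq3
    have hv : v = b := by
      rcases h2 with h | h | h
      · exact h
      · rw [h] at h3; simp_all
      · rw [h] at h3; simp_all
    rcases h1 with h | h | h
    · rw [h] at h3; simp_all
    · exact he.2.1 (by rw [h, hv])
    · exact he.2.2 (by rw [h, hv])) x
  have e1 : ∀ y : Fin 3 → Ω, edgeProd U E (Function.extend j y x) =
      d 0 (y 0) * (U (y 1, y 0) * d 1 (y 1)) * (U (y 2, y 0) * d 2 (y 2)) := by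
    intro y
    have h0 : Function.extend j y x b = y 0 := hji.extend_apply y x 0
    have h1 : Function.extend j y x p = y 1 := hji.extend_apply y x 1
    have h2 : Function.extend j y x q = y 2 := hji.extend_apply y x 2
    have h3 := hdy y
    rw [Fin.prod_univ_three, edgeProd] at h3
    rw [edgeProd, ← Finset.prod_sdiff hTE, h3, hT,
      Finset.prod_pair (fun h => hpq (Prod.ext_iff.1 h).1)]
    simp only [h0, h1, h2]
    ring
  have hb : IsUnitBounded (fun y : Fin 3 → Ω =>
      d 0 (y 0) * (U (y 1, y 0) * d 1 (y 1)) * (U (y 2, y 0) * d 2 (y 2))) :=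
    (((hd 0).comp (by fun_prop)).mul
      ((hU.comp (by fun_prop)).mul ((hd 1).comp (by fun_prop)))).mul
      ((hU.comp (by fun_prop)).mul ((hd 2).comp (by fun_prop)))
  simp only [e1]
  rw [integral_fin_three hb]
  refine le_trans (le_of_eq ?_) (abs_integral_path_le hU (hd 1) (hd 2) (hd 0))
  congr 2; ext β
  change ∫ α, ∫ γ, d 0 β * (U (α, β) * d 1 α) * (U (γ, β) * d 2 γ) = _
  simp only [integral_const_mul]
  rw [integral_mul_const, integral_const_mul]

variable [Fintype V]

-- Only the endpoints of two edges of the star are resampled; the remaining edges form a weight at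
-- its centre, which the weighted codegree estimate absorbs.
open Classical in
theorem integral_starMarginal_sq_le (hU : IsUnitBounded U) {S : Finset (V × V)} {e₁ e₂ : V × V}
    (h₁ : e₁ ∈ S) (h₂ : e₂ ∈ S) (hne : e₁.2 ≠ e₂.2) (hS : Set.InjOn Prod.snd (S : Set (V × V))) :
    ∫ x : V → Ω, starMarginal U S x ^ 2 ≤ codegreeSq U := by
  set j : Fin 2 → V := ![e₁.2, e₂.2] with hj
  have hji : j.Injective := by
    intro a b hab
    fin_cases a <;> fin_cases b <;> simp_all
  rw [← integral_extend hji (isUnitBounded_starMarginal hU S).sq]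
  have hinner : ∀ x : V → Ω,
      ‖∫ y : Fin 2 → Ω, starMarginal U S (Function.extend j y x) ^ 2‖ ≤ codegreeSq U := by
    intro x
    rw [Real.norm_of_nonneg (integral_nonneg fun _ => sq_nonneg _)]
    set T : Finset (V × V) := {e₁, e₂} with hT
    have hTS : T ⊆ S := by
      intro e he
      rw [hT, Finset.mem_insert, Finset.mem_singleton] at he
      rcases he with rfl | rfl <;> assumption
    set h : Ω → ℝ := fun a => ∏ e ∈ S \ T, U (a, x e.2) with hh
    have hhb : IsUnitBounded h := .prod _ fun _ _ => hU.comp (by fun_prop)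
    have e1 : ∀ y : Fin 2 → Ω, starMarginal U S (Function.extend j y x) =
        ∫ a, U (a, y 0) * U (a, y 1) * h a := by
      intro y
      unfold starMarginal
      congr 1; ext a
      have h0 : Function.extend j y x e₁.2 = y 0 := hji.extend_apply y x 0
      have h1 : Function.extend j y x e₂.2 = y 1 := hji.extend_apply y x 1
      rw [← Finset.prod_sdiff hTS, hT, Finset.prod_pair (fun h => hne (congrArg Prod.snd h)),
        h0, h1, mul_comm]
      congr 1
      refine Finset.prod_congr rfl fun e he => ?_
      rw [Finset.mem_sdiff, hT, Finset.mem_insert, Finset.mem_singleton, not_or] at he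
      rw [Function.extend_apply']
      rintro ⟨k, hk⟩
      fin_cases k
      · exact he.2.1 (hS he.1 h₁ hk.symm)
      · exact he.2.2 (hS he.1 h₂ hk.symm)
    have hk : IsUnitBounded (fun p : Ω × Ω => ∫ a, U (a, p.1) * U (a, p.2) * h a) :=
      IsUnitBounded.integral_right
        (f := fun q : (Ω × Ω) × Ω => U (q.2, q.1.1) * U (q.2, q.1.2) * h q.2)
        (((hU.comp (by fun_prop)).mul (hU.comp (by fun_prop))).mul (hhb.comp (by fun_prop))) volume
    simp only [e1]
    rw [integral_fin_two (hk.sq.comp (h := fun y : Fin 2 → Ω => (y 0, y 1)) (by fun_prop))]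
    refine le_trans (le_of_eq ?_) (integral_weighted_codegree_sq_le hU hhb)
    exact (integral_prod _ (hk.sq.integrable (volume.prod volume))).symm
  have := norm_integral_le_of_norm_le_const (μ := (volume : Measure (V → Ω))) (.of_forall hinner)
  exact (le_abs_self _).trans (by simpa using this)

open Classical in
theorem integral_edgeProd_eq_starMarginal (hU : IsUnitBounded U) {E : Finset (V × V)} {w : V}
    (hw : ∀ e ∈ E, e.2 ≠ w) :
    ∫ x : V → Ω, edgeProd U E x = ∫ x : V → Ω, starMarginal U {e ∈ E | e.1 = w} x *
      edgeProd U {e ∈ E | e.1 ≠ w} x := by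
  set j : Fin 1 → V := ![w] with hj
  have hji : j.Injective := Function.injective_of_subsingleton _
  have hjr : ∀ v, v ∈ Set.range j ↔ v = w := by
    intro v; simp [hj, eq_comm]
  have hs : E \ {e ∈ E | e.1 = w} = {e ∈ E | e.1 ≠ w} := by
    ext e; simp only [Finset.mem_sdiff, Finset.mem_filter]; tauto
  rw [integral_edgeProd_union hU hji (Finset.filter_subset (fun e => e.1 = w) E) ?_, hs]
  · congr 1; ext x
    congr 1
    have hm := (measurable_extend (Ω := Ω) j).comp (measurable_prodMk_left (x := x))
    refine (integral_fin_succ ((isUnitBounded_edgeProd hU _).comp hm)).trans ?_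
    rw [starMarginal]
    congr 1; ext a
    refine (integral_fin_zero _).trans ?_
    refine Finset.prod_congr rfl fun e he => ?_
    rw [Finset.mem_filter] at he
    have h0 : Function.extend j (Fin.cons a ![]) x w = a := hji.extend_apply (Fin.cons a ![]) x 0
    change U (Function.extend j (Fin.cons a ![]) x e.1,
      Function.extend j (Fin.cons a ![]) x e.2) = _
    rw [he.2, h0, Function.extend_apply' _ _ e.2 fun h => hw e he.1 ((hjr _).1 h)]
  · intro e he
    rw [hs, Finset.mem_filter] at he
    rw [hjr, hjr]
    exact ⟨he.2, hw e he.1⟩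

open Classical in
/-- A graph with a `4`-cycle that avoids a node `w` of degree at least `2`, and a node `b` in the
other class that is not joined to `w` and has degree at least `2`. -/
theorem abs_integral_edgeProd_le_of_not_mem (hU : IsUnitBounded U) {c : Fin 4 → Bool}
    (hc : ∀ i, c (i + 1) = !c i) {i : Fin 4 → V} (hi : i.Injective) {E : Finset (V × V)}
    (hcE : ∀ k, cycleEdge i c k ∈ E)
    (hE : ∀ e ∈ E, e.1 ∈ Set.range i → e.2 ∈ Set.range i → ∃ k, e = cycleEdge i c k)
    {χ : V → Bool} (hχ : ∀ e ∈ E, χ e.1 = true ∧ χ e.2 = false)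
    {w v₁ v₂ b p q : V} (hwi : w ∉ Set.range i) (hw : χ w = true)
    (hv : v₁ ≠ v₂) (hv₁ : (w, v₁) ∈ E) (hv₂ : (w, v₂) ∈ E) (hwb : (w, b) ∉ E)
    (hpq : p ≠ q) (hp : (p, b) ∈ E) (hq : (q, b) ∈ E)
    (hN : ∀ k, (w, i k) ∈ E → k.val = 0 ∨ k.val = 2) :
    |∫ x : V → Ω, edgeProd U E x| ≤ √√(codegreeSq U) * codegreeSq U := by
  set S : Finset (V × V) := {e ∈ E | e.1 = w} with hS
  set E' : Finset (V × V) := {e ∈ E | e.1 ≠ w} with hE'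
  set N : Set V := {v | (w, v) ∈ E} with hNdef
  have hE'E : E' ⊆ E := Finset.filter_subset _ _
  have hpw : p ≠ w := by rintro rfl; exact hwb hp
  have hqw : q ≠ w := by rintro rfl; exact hwb hq
  have hp' : (p, b) ∈ E' := Finset.mem_filter.2 ⟨hp, hpw⟩
  have hq' : (q, b) ∈ E' := Finset.mem_filter.2 ⟨hq, hqw⟩
  have hsnd : ∀ e ∈ E, e.2 ≠ w := by
    rintro e he rfl
    have := hχ e he
    simp_all
  have hA : IsUnitBounded (edgeProd U E' : (V → Ω) → ℝ) := isUnitBounded_edgeProd hU E'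
  have hK : IsUnitBounded (starMarginal U S : (V → Ω) → ℝ) := isUnitBounded_starMarginal hU S
  have hKN : DependsOn (starMarginal U S : (V → Ω) → ℝ) N := by
    intro x y h
    unfold starMarginal
    congr 1; ext a
    refine Finset.prod_congr rfl fun e he => ?_
    rw [hS, Finset.mem_filter] at he
    rw [h e.2 (by rw [hNdef, Set.mem_ofPred_eq, ← he.2]; exact he.1)]
  -- The conditional expectation of the edges away from w, given the coordinates in N.
  set G : (V → Ω) → ℝ := fun x => ∫ z, edgeProd U E' (Nᶜ.piecewise z x) with hG
  have hGb : IsUnitBounded G := (hA.comp (measurable_piecewise_pair Nᶜ)).integral_right volume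
  have hpwN : ∀ (x z : V → Ω), ∀ v ∈ N, Nᶜ.piecewise z x v = x v := fun x z v hv =>
    Set.piecewise_eq_of_notMem _ _ _ (by simpa)
  have hmul : ∀ {s : (V → Ω) → ℝ}, IsUnitBounded s → DependsOn s N →
      ∫ x, s x * edgeProd U E' x = ∫ x, s x * G x := by
    intro s hs hsN
    rw [← integral_piecewise Nᶜ (hs.mul hA)]
    congr 1; ext x
    rw [hG, ← integral_const_mul]
    congr 1; ext z
    rw [hsN (hpwN x z)]
  have hGN : DependsOn G N := by
    intro x y h
    simp only [hG]
    congr 1; ext z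
    congr 1; ext v
    by_cases hvN : v ∈ N
    · rw [hpwN x z v hvN, hpwN y z v hvN, h v hvN]
    · rw [Set.piecewise_eq_of_mem _ _ _ hvN, Set.piecewise_eq_of_mem _ _ _ hvN]
  have hGle : ∀ x, |G x| ≤ √(codegreeSq U) := by
    intro x
    have hj : (![b, p, q] : Fin 3 → V).Injective := by
      have hbp : b ≠ p := by
        rintro rfl; have := hχ _ hp; simp_all
      have hbq : b ≠ q := by
        rintro rfl; have := hχ _ hq; simp_all
      intro a b hab
      fin_cases a <;> fin_cases b <;> simp_all
    -- b is not a neighbour of w, and p and q are in the class of w; so the path at b is integrated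
    -- in full when N is fixed.
    have hpN : ∀ k, ![b, p, q] k ∉ N := by
      have h1 := hχ _ hp
      have h2 := hχ _ hq
      intro k hk
      have h3 := hχ _ hk
      fin_cases k
      · exact hwb hk
      · simp_all
      · simp_all
    simp only [hG]
    rw [← integral_extend hj (hA.comp (measurable_piecewise_left Nᶜ x))]
    have hcomm : ∀ (z : V → Ω) (y : Fin 3 → Ω),
        Nᶜ.piecewise (Function.extend ![b, p, q] y z) x =
          Function.extend ![b, p, q] y (Nᶜ.piecewise z x) := by
      intro z y
      ext v
      by_cases hvj : v ∈ Set.range ![b, p, q]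
      · obtain ⟨k, rfl⟩ := hvj
        rw [Set.piecewise_eq_of_mem _ _ _ (hpN k), hj.extend_apply, hj.extend_apply]
      · rw [Function.extend_apply' _ _ _ hvj]
        by_cases hvN : v ∈ N
        · rw [hpwN _ _ v hvN, hpwN _ _ v hvN]
        · rw [Set.piecewise_eq_of_mem _ _ _ hvN, Set.piecewise_eq_of_mem _ _ _ hvN,
            Function.extend_apply' _ _ _ hvj]
    simp only [hcomm]
    have hinner : ∀ z : V → Ω, ‖∫ y : Fin 3 → Ω, edgeProd U E'
        (Function.extend ![b, p, q] y (Nᶜ.piecewise z x))‖ ≤ √(codegreeSq U) := fun z =>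
      abs_integral_edgeProd_le_of_path hU (fun e he => hχ e (hE'E he)) hpq hp' hq' _
    have := norm_integral_le_of_norm_le_const (μ := (volume : Measure (V → Ω)))
      (.of_forall hinner)
    simpa using this
  have hGabs : ∫ x, |G x| ≤ codegreeSq U := by
    -- The sign of G depends on N only, and N meets the 4-cycle in antipodal nodes only, so it is an
    -- admissible extra factor.
    set s : (V → Ω) → ℝ := fun x => if 0 ≤ G x then 1 else -1 with hs
    have hsb : IsUnitBounded s := by
      refine ⟨Measurable.ite (measurableSet_le measurable_const hGb.meas)
        measurable_const measurable_const, fun x => ?_⟩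
      simp only [hs]
      split_ifs <;> simp
    have hsN : DependsOn s N := by
      intro x y h
      simp only [hs, hGN h]
    have e : ∀ x, |G x| = s x * G x := by
      intro x
      simp only [hs]
      split_ifs with h
      · rw [abs_of_nonneg h, one_mul]
      · rw [abs_of_neg (not_le.1 h)]; ring
    simp only [e]
    rw [← hmul hsb hsN, ← weightedCycle_four_eq hU]
    refine (le_abs_self _).trans ?_
    refine abs_integral_mul_edgeProd_le (r := 2) rfl le_rfl hU hc
      (parityColor_add_one (n := 4) (r := 2) rfl le_rfl) hi (fun k => ?_)
      (fun e he => hE e (hE'E he)) hsb hsN hN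
    refine Finset.mem_filter.2 ⟨hcE k, fun h => hwi ?_⟩
    rw [← h]
    unfold cycleEdge
    split_ifs <;> exact Set.mem_range_self _
  have hG2 : ∫ x, G x ^ 2 ≤ √(codegreeSq U) * codegreeSq U := by
    refine le_trans ?_ (mul_le_mul_of_nonneg_left hGabs (Real.sqrt_nonneg _))
    rw [← integral_const_mul]
    refine integral_mono (hGb.sq.integrable _) ((hGb.abs.integrable _).const_mul _) fun x => ?_
    dsimp only
    rw [← sq_abs, pow_two]
    exact mul_le_mul_of_nonneg_right (hGle x) (abs_nonneg _)
  have hK2 : ∫ x : V → Ω, starMarginal U S x ^ 2 ≤ codegreeSq U := by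
    refine integral_starMarginal_sq_le hU (e₁ := (w, v₁)) (e₂ := (w, v₂))
      (Finset.mem_filter.2 ⟨hv₁, rfl⟩) (Finset.mem_filter.2 ⟨hv₂, rfl⟩) hv ?_
    intro e he e' he' h
    have h1 := (Finset.mem_filter.1 he).2
    have h2 := (Finset.mem_filter.1 he').2
    exact Prod.ext (h1.trans h2.symm) h
  -- The star at w depends on N only, so the other edges may be replaced by G before Cauchy-Schwarz.
  rw [integral_edgeProd_eq_starMarginal hU hsnd, hmul hK hKN]
  have hc0 := codegreeSq_nonneg U
  refine abs_le_of_sq_le_sq ?_ (mul_nonneg (Real.sqrt_nonneg _) hc0)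
  refine (integral_mul_sq_le hK hGb).trans ?_
  rw [mul_pow, Real.sq_sqrt (Real.sqrt_nonneg _)]
  calc _ ≤ codegreeSq U * (√(codegreeSq U) * codegreeSq U) :=
        mul_le_mul hK2 hG2 (integral_nonneg fun _ => sq_nonneg _) hc0
    _ = _ := by ring

end GirthFour

/-! ### Chords, common neighbours and outer edges of a shortest cycle. -/

section ShortestCycles

variable {V : Type*} {F : SimpleGraph V} {n : ℕ} [NeZero n]

theorem Fin.val_sub_add_one (hn : 2 ≤ n) {k l : Fin n} (h : (l - k).val ≠ 0) :
    (l - (k + 1)).val + 1 = (l - k).val := by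
  have h1 := Fin.val_add_one_eq_ite hn (l - (k + 1))
  have h2 : l - (k + 1) + 1 = l - k := by abel
  rw [h2] at h1
  split_ifs at h1 <;> omega

theorem Fin.val_sub_add_val_sub {k l : Fin n} (h : k ≠ l) :
    (l - k).val + (k - l).val = n := by
  have h1 := Fin.val_neg_eq_ite (l - k)
  rw [neg_sub] at h1
  have h2 : (l - k).val ≠ 0 := fun h0 =>
    h (sub_eq_zero.1 (Fin.ext (by rw [h0, Fin.val_zero]))).symm
  rw [if_neg h2] at h1
  have := (l - k).isLt
  omega

theorem Fin.eq_add_one_of_val_sub_eq_one (hn : 2 ≤ n) {k l : Fin n} (h : (l - k).val = 1) :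
    l = k + 1 := by
  have h1 := Fin.val_sub_add_one hn (k := k) (l := l) (by omega)
  refine sub_eq_zero.1 (Fin.ext ?_)
  rw [Fin.val_zero]
  omega

/-- The arc of a cycle between two nodes. -/
theorem exists_arc (hn : 2 ≤ n) {i : Fin n → V} (hi : i.Injective)
    (hadj : ∀ k, F.Adj (i k) (i (k + 1))) (l k : Fin n) :
    ∃ p : F.Walk (i k) (i l), p.IsPath ∧ p.length = (l - k).val ∧
      ∀ v ∈ p.support, ∃ m, v = i m ∧ (l - m).val ≤ (l - k).val := by
  induction hd : (l - k).val generalizing k with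
  | zero =>
    obtain rfl : l = k := sub_eq_zero.1 (Fin.ext (by rw [hd, Fin.val_zero]))
    refine ⟨.nil, .nil, rfl, fun v hv => ⟨l, by simpa using hv, by simp⟩⟩
  | succ d ih =>
    have h1 := Fin.val_sub_add_one hn (k := k) (l := l) (by omega)
    obtain ⟨p, hp, hpl, hps⟩ := ih (k + 1) (by omega)
    refine ⟨.cons (hadj k) p, hp.cons fun hk => ?_, by simp [hpl], fun v hv => ?_⟩
    · obtain ⟨m, hm, hml⟩ := hps _ hk
      rw [← hi hm] at hml
      omega
    · rw [SimpleGraph.Walk.support_cons, List.mem_cons] at hv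
      rcases hv with rfl | hv
      · exact ⟨k, rfl, hd.le⟩
      · obtain ⟨m, hm, hml⟩ := hps v hv
        exact ⟨m, hm, by omega⟩

/-- The edge closes the path to a cycle; length at least 2 ensures that the path is not this edge
itself. -/
theorem SimpleGraph.le_length_of_isPath {n : ℕ} (hg : (n : ℕ∞) ≤ F.egirth) {a b : V}
    {p : F.Walk a b} (hp : p.IsPath) (hl : 2 ≤ p.length) (h : F.Adj b a) : n ≤ p.length + 1 := by
  have hc : (SimpleGraph.Walk.cons h p).IsCycle := by
    rw [SimpleGraph.Walk.isCycle_iff_isPath_tail_and_le_length]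
    exact ⟨by simpa using hp, by rw [SimpleGraph.Walk.length_cons]; omega⟩
  have := hg.trans (SimpleGraph.egirth_le_length hc)
  rw [SimpleGraph.Walk.length_cons] at this
  exact_mod_cast this

theorem chord_mem_cycle (hn : 2 ≤ n) (hg : (n : ℕ∞) ≤ F.egirth)
    {i : Fin n → V} (hi : i.Injective) (hadj : ∀ k, F.Adj (i k) (i (k + 1))) {k l : Fin n}
    (h : F.Adj (i k) (i l)) : k = l + 1 ∨ l = k + 1 := by
  have hne : k ≠ l := by rintro rfl; exact F.irrefl h
  have hs := Fin.val_sub_add_val_sub hne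
  by_cases h1 : (l - k).val ≤ 1
  · have h2 : (l - k).val ≠ 0 := fun h0 =>
      hne (sub_eq_zero.1 (Fin.ext (by rw [h0, Fin.val_zero]))).symm
    exact .inr (Fin.eq_add_one_of_val_sub_eq_one hn (by omega))
  -- A chord closes this arc to a cycle, so the arc has at least n - 1 edges, and the complementary
  -- arc is a single edge.
  · obtain ⟨p, hp, hpl, -⟩ := exists_arc hn hi hadj l k
    have := SimpleGraph.le_length_of_isPath hg hp (by omega) h.symm
    exact .inl (Fin.eq_add_one_of_val_sub_eq_one hn (by omega))

/-- An arc together with the detour through w is a cycle. Applied to both arcs, whose lengths sum to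
n, this forces n ≤ 4. -/
theorem le_add_two_of_common_neighbor (hn : 2 ≤ n) (hg : (n : ℕ∞) ≤ F.egirth)
    {i : Fin n → V} (hi : i.Injective) (hadj : ∀ k, F.Adj (i k) (i (k + 1)))
    {w : V} (hw : w ∉ Set.range i) {k l : Fin n} (hkl : k ≠ l)
    (hk : F.Adj w (i k)) (hl : F.Adj w (i l)) : n ≤ (l - k).val + 2 := by
  obtain ⟨p, hp, hpl, hps⟩ := exists_arc hn hi hadj l k
  have hs := Fin.val_sub_add_val_sub hkl
  have := (k - l).isLt
  have := SimpleGraph.le_length_of_isPath hg (p := .cons hk p)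
    (hp.cons fun h => by obtain ⟨m, hm, -⟩ := hps _ h; exact hw ⟨m, hm.symm⟩)
    (by rw [SimpleGraph.Walk.length_cons]; omega) hl.symm
  rw [SimpleGraph.Walk.length_cons] at this
  omega

/-- An arc is closed by the three edges through w and z. Applied to both arcs when k ≠ l, this
forces n ≤ 6. -/
theorem le_add_three_of_outer_edge (hn : 2 ≤ n) (hg : (n : ℕ∞) ≤ F.egirth)
    {i : Fin n → V} (hi : i.Injective) (hadj : ∀ k, F.Adj (i k) (i (k + 1)))
    {w z : V} (hw : w ∉ Set.range i) (hz : z ∉ Set.range i)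
    (hwz : F.Adj w z) {k l : Fin n} (hk : F.Adj w (i k)) (hl : F.Adj z (i l)) :
    n ≤ (l - k).val + 3 := by
  obtain ⟨p, hp, hpl, hps⟩ := exists_arc hn hi hadj l k
  have hw' : w ∉ p.support := fun h => by
    obtain ⟨m, hm, -⟩ := hps _ h; exact hw ⟨m, hm.symm⟩
  have hz' : z ∉ (SimpleGraph.Walk.cons hk p).support := fun h => by
    rw [SimpleGraph.Walk.support_cons, List.mem_cons] at h
    rcases h with h | h
    · exact hwz.ne h.symm
    · obtain ⟨m, hm, -⟩ := hps _ h; exact hz ⟨m, hm.symm⟩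
  have := SimpleGraph.le_length_of_isPath hg (p := .cons hwz.symm (.cons hk p))
    ((hp.cons hw').cons hz') (by simp) hl.symm
  simp only [SimpleGraph.Walk.length_cons] at this
  omega

theorem isSingleCycle_of_surjective (hn : 2 ≤ n) (hg : (n : ℕ∞) ≤ F.egirth)
    {i : Fin n → V} (hi : i.Injective) (hadj : ∀ k, F.Adj (i k) (i (k + 1)))
    (hn3 : 3 ≤ n) (hs : i.Surjective) : IsSingleCycle F := by
  have hb : i.Bijective := ⟨hi, hs⟩
  refine ⟨n, hn3, ⟨SimpleGraph.Iso.symm ⟨Equiv.ofBijective i hb, ?_⟩⟩⟩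
  intro k l
  change F.Adj (i k) (i l) ↔ _
  rw [SimpleGraph.cycleGraph_adj_iff_add_one hn]
  refine ⟨chord_mem_cycle hn hg hi hadj, ?_⟩
  rintro (rfl | rfl)
  · exact (hadj _).symm
  · exact hadj _

end ShortestCycles

theorem isCompleteBipartiteGraph_of_forall_adj {V : Type*} [Fintype V] {F : SimpleGraph V}
    (c : F.Coloring Bool) (h : ∀ u v, c u = true → c v = false → F.Adj u v) :
    IsCompleteBipartiteGraph F := by
  classical
  let e : V ≃ Fin (Fintype.card {v // c v = true}) ⊕ Fin (Fintype.card {v // ¬ c v = true}) :=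
    (Equiv.sumCompl fun v => c v = true).symm.trans
      (Equiv.sumCongr (Fintype.equivFin _) (Fintype.equivFin _))
  have hL : ∀ v, (e v).isLeft = c v := by
    intro v
    by_cases hv : c v = true
    · simp [e, Equiv.sumCompl_symm_apply_of_pos (p := fun v => c v = true) hv, hv]
    · simp [e, Equiv.sumCompl_symm_apply_of_neg (p := fun v => c v = true) hv, hv]
  have hR : ∀ v, (e v).isRight = !c v := by
    intro v
    rw [← hL]; cases e v <;> rfl
  refine ⟨_, _, ⟨⟨e, ?_⟩⟩⟩
  intro u v
  simp only [completeBipartiteGraph_adj, hL, hR]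
  constructor
  · rintro (⟨h1, h2⟩ | ⟨h1, h2⟩)
    · exact h u v h1 (by simpa using h2)
    · exact (h v u h2 (by simpa using h1)).symm
  · intro huv
    have := c.valid huv
    cases hu : c u <;> cases hv : c v <;> simp_all

/-! ### Passing to a Borel measurable kernel. -/

section Replacement

variable {V : Type*} [Fintype V]

open Classical in
/-- The edges of a bigraph as pairs, the endpoint of colour `true` first. -/
noncomputable def bigraphEdges (F : SimpleGraph V) (c : F.Coloring Bool) : Finset (V × V) :=
  {e : V × V | F.Adj e.1 e.2 ∧ c e.1 = true}

theorem mem_bigraphEdges {F : SimpleGraph V} {c : F.Coloring Bool} {e : V × V} :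
    e ∈ bigraphEdges F c ↔ F.Adj e.1 e.2 ∧ c e.1 = true := by
  simp [bigraphEdges]

theorem bigraphDensity_eq_integral_edgeProd (F : SimpleGraph V) (c : F.Coloring Bool)
    (U : I × I → ℝ) : bigraphDensity F c U = ∫ x : V → I, edgeProd U (bigraphEdges F c) x :=
  rfl

theorem measurePreserving_eval_pair {Ω : Type*} [MeasureSpace Ω]
    [IsProbabilityMeasure (volume : Measure Ω)] {a b : V} (h : a ≠ b) :
    MeasurePreserving (fun x : V → Ω => (x a, x b)) := by
  have hi : (![a, b] : Fin 2 → V).Injective := by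
    intro k l hkl
    fin_cases k <;> fin_cases l <;> simp_all
  exact (volume_preserving_finTwoArrow Ω).comp (measurePreserving_comp_injective (Ω := Ω) hi)

/-- The endpoints of an edge are distinct, so their coordinates are jointly uniform on the square
and null sets pull back to null sets. -/
theorem bigraphDensity_congr_ae (F : SimpleGraph V) (c : F.Coloring Bool) {U U' : I × I → ℝ}
    (h : U =ᵐ[volume] U') : bigraphDensity F c U = bigraphDensity F c U' := by
  rw [bigraphDensity_eq_integral_edgeProd, bigraphDensity_eq_integral_edgeProd]
  refine integral_congr_ae ?_
  have hall : ∀ᵐ x : V → I, ∀ e ∈ bigraphEdges F c, U (x e.1, x e.2) = U' (x e.1, x e.2) := by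
    rw [Filter.eventually_all_finset]
    intro e he
    have hne := (mem_bigraphEdges.1 he).1.ne
    exact (measurePreserving_eval_pair (Ω := I) hne).quasiMeasurePreserving.ae h
  filter_upwards [hall] with x hx
  exact Finset.prod_congr rfl hx

theorem IsUnitKernel.exists_isUnitBounded {U : I × I → ℝ} (hU : IsUnitKernel U) :
    ∃ U' : I × I → ℝ, IsUnitBounded U' ∧ U =ᵐ[volume] U' := by
  -- A measurable version of U may leave [-1, 1] on a null set, hence the truncation.
  refine ⟨fun p => max (-1) (min 1 (hU.aemeasurable.mk U p)),
    ⟨measurable_const.max (measurable_const.min hU.aemeasurable.measurable_mk), fun p => ?_⟩, ?_⟩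
  · rw [abs_le]
    exact ⟨le_max_left _ _, max_le (by norm_num) (min_le_left _ _)⟩
  · filter_upwards [hU.aemeasurable.ae_eq_mk] with p hp
    rw [← hp, min_eq_right (hU.mem_Icc p).2, max_eq_right (hU.mem_Icc p).1]

end Replacement

/-! ### The two girth cases and the conclusion. -/

section Main

variable {V : Type*} {F : SimpleGraph V} {n : ℕ} [NeZero n]

/-- Exchanging the two classes of a bigraph. -/
def SimpleGraph.Coloring.flip (c : F.Coloring Bool) : F.Coloring Bool :=
  SimpleGraph.Coloring.mk (fun v => !c v) fun {u v} h => by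
    have := c.valid h
    simpa using this

theorem SimpleGraph.Coloring.flip_apply (c : F.Coloring Bool) (v : V) : c.flip v = !c v := rfl

theorem coloring_add_one (c : F.Coloring Bool) {i : Fin n → V}
    (hadj : ∀ k, F.Adj (i k) (i (k + 1))) (k : Fin n) : c (i (k + 1)) = !c (i k) := by
  have := c.valid (hadj k)
  cases h : c (i k) <;> cases h' : c (i (k + 1)) <;> simp_all

theorem SimpleGraph.exists_ne_adj_of_two_le_degree (v : V) [Fintype (F.neighborSet v)]
    (h : 2 ≤ F.degree v) : ∃ a b, a ≠ b ∧ F.Adj v a ∧ F.Adj v b := by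
  obtain ⟨a, ha, b, hb, hab⟩ := Finset.one_lt_card.1 (show 1 < (F.neighborFinset v).card from h)
  exact ⟨a, b, hab, by simpa using ha, by simpa using hb⟩

theorem SimpleGraph.exists_cycle_of_egirth_eq {n : ℕ} [NeZero n] (h : F.egirth = (n : ℕ∞)) :
    3 ≤ n ∧ ∃ i : Fin n → V, i.Injective ∧ ∀ k, F.Adj (i k) (i (k + 1)) := by
  have h3 : 3 ≤ n := by
    have := F.three_le_egirth
    rw [h] at this
    exact_mod_cast this
  have hac : ¬ F.IsAcyclic := by
    rw [← SimpleGraph.egirth_eq_top, h]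
    exact ENat.natCast_ne_top n
  obtain ⟨a, w, hw, hwl⟩ := SimpleGraph.exists_egirth_eq_length.2 hac
  rw [h] at hwl
  obtain ⟨f⟩ := (SimpleGraph.cycleGraph_isContained_iff (G := F) (n := n) (by omega)).2
    ⟨a, w, hw, by exact_mod_cast hwl.symm⟩
  refine ⟨h3, f, f.injective, fun k => f.toHom.map_adj ?_⟩
  exact (SimpleGraph.cycleGraph_adj_iff_add_one (by omega)).2 (.inr rfl)

/-- A cycle with its nodes numbered from another starting point. -/
theorem rotate_cycle {i : Fin n → V} (hi : i.Injective) (hadj : ∀ k, F.Adj (i k) (i (k + 1)))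
    (k₀ : Fin n) : (fun k => i (k + k₀)).Injective ∧
      (∀ k, F.Adj (i (k + k₀)) (i (k + 1 + k₀))) ∧
      Set.range (fun k => i (k + k₀)) = Set.range i := by
  refine ⟨fun k l h => add_right_cancel (hi h), fun k => ?_, ?_⟩
  · have := hadj (k + k₀)
    rwa [add_right_comm] at this
  · exact (Equiv.addRight k₀).surjective.range_comp i

variable [Fintype V]

theorem bigraphDensity_flip (c : F.Coloring Bool) (U : I × I → ℝ) :
    bigraphDensity F c.flip (U ∘ Prod.swap) = bigraphDensity F c U := by
  rw [bigraphDensity_eq_integral_edgeProd, bigraphDensity_eq_integral_edgeProd]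
  congr 1; ext x
  refine Finset.prod_nbij' Prod.swap Prod.swap ?_ ?_ (by simp) (by simp) (fun _ _ => rfl)
  all_goals
    rintro ⟨u, v⟩ he
    rw [mem_bigraphEdges] at he ⊢
    have := c.valid he.1
    refine ⟨he.1.symm, ?_⟩
    have h2 := he.2
    cases hu : c u <;> cases hv : c v <;> simp_all [SimpleGraph.Coloring.flip_apply]

/-- Swapping the arguments of U amounts to exchanging the two classes of the 4-cycle, which does not
affect its density. -/
theorem codegreeSq_comp_swap {U : I × I → ℝ} (hU : IsUnitBounded U) :
    codegreeSq (U ∘ Prod.swap) = codegreeSq U := by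
  have hp := parityColor_add_one (n := 4) (r := 2) rfl le_rfl
  have hU' : IsUnitBounded (U ∘ Prod.swap) := hU.comp measurable_swap
  rw [← weightedCycle_four_eq hU, ← weightedCycle_four_eq hU',
    weightedCycle_one_eq hU hp (c' := fun i => !parityColor 4 i) fun i => by rw [hp]]
  unfold weightedCycle
  refine integral_congr_ae (.of_forall fun y => ?_)
  refine congrArg _ (Finset.prod_congr rfl fun i _ => ?_)
  simp only [cycleFactor]
  by_cases h : parityColor 4 i = true <;> simp [h]

theorem cycleEdge_mem_bigraphEdges (c : F.Coloring Bool) {i : Fin n → V}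
    (hadj : ∀ k, F.Adj (i k) (i (k + 1))) (k : Fin n) :
    cycleEdge i (fun k => c (i k)) k ∈ bigraphEdges F c := by
  rw [mem_bigraphEdges, cycleEdge]
  split_ifs with h
  · exact ⟨hadj k, h⟩
  · refine ⟨(hadj k).symm, ?_⟩
    simp only [coloring_add_one c hadj]
    simpa using h

theorem eq_cycleEdge_of_mem_bigraphEdges (hn : 2 ≤ n) (hg : (n : ℕ∞) ≤ F.egirth)
    (c : F.Coloring Bool) {i : Fin n → V} (hi : i.Injective)
    (hadj : ∀ k, F.Adj (i k) (i (k + 1))) {e : V × V} (he : e ∈ bigraphEdges F c)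
    (h₁ : e.1 ∈ Set.range i) (h₂ : e.2 ∈ Set.range i) :
    ∃ k, e = cycleEdge i (fun k => c (i k)) k := by
  obtain ⟨u, v⟩ := e
  obtain ⟨k, rfl⟩ := h₁
  obtain ⟨l, rfl⟩ := h₂
  rw [mem_bigraphEdges] at he
  rcases chord_mem_cycle hn hg hi hadj he.1 with rfl | rfl
  · refine ⟨l, ?_⟩
    have h2 := he.2
    simp only [coloring_add_one c hadj] at h2
    have h3 : ¬ c (i l) = true := by simpa using h2
    rw [cycleEdge, if_neg h3]
  · exact ⟨k, by rw [cycleEdge, if_pos he.2]⟩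

theorem bigraphEdges_color (c : F.Coloring Bool) :
    ∀ e ∈ bigraphEdges F c, c e.1 = true ∧ c e.2 = false := by
  intro e he
  rw [mem_bigraphEdges] at he
  have := c.valid he.1
  refine ⟨he.2, ?_⟩
  cases h : c e.2 <;> simp_all

theorem bigraphDensity_le_of_six_le {r : ℕ} (hn : n = 2 * r) (hr : 3 ≤ r)
    [DecidableRel F.Adj] (c : F.Coloring Bool) (hdeg : ∀ v, 2 ≤ F.degree v)
    (hg : F.egirth = (n : ℕ∞)) (hcycle : ¬ IsSingleCycle F) {U : I × I → ℝ}
    (hU : IsUnitBounded U) :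
    bigraphDensity F c U ≤ √√(codegreeSq U) * weightedCycle U (parityColor n) fun _ _ => 1 := by
  obtain ⟨-, i, hi, hadj⟩ := SimpleGraph.exists_cycle_of_egirth_eq hg
  have hn2 : 2 ≤ n := by omega
  have huniq : ∀ w ∉ Set.range i, ∀ k l, F.Adj w (i k) → F.Adj w (i l) → k = l := by
    intro w hw k l hk hl
    by_contra hkl
    have h1 := le_add_two_of_common_neighbor hn2 hg.ge hi hadj hw hkl hk hl
    have h2 := le_add_two_of_common_neighbor hn2 hg.ge hi hadj hw (Ne.symm hkl) hl hk
    have h3 := Fin.val_sub_add_val_sub hkl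
    omega
  obtain ⟨w, z, hwz, hw, hz, hcw⟩ : ∃ w z, F.Adj w z ∧ w ∉ Set.range i ∧ z ∉ Set.range i ∧
      c w = true := by
    obtain ⟨w, hw⟩ : ∃ w, w ∉ Set.range i := by
      by_contra! h
      exact hcycle (isSingleCycle_of_surjective hn2 hg.ge hi hadj (by omega) h)
    obtain ⟨z, hwz, hz⟩ : ∃ z, F.Adj w z ∧ z ∉ Set.range i := by
      obtain ⟨a, b, hab, ha, hb⟩ := SimpleGraph.exists_ne_adj_of_two_le_degree w (hdeg w)
      by_contra! h
      obtain ⟨k, rfl⟩ := h a ha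
      obtain ⟨l, rfl⟩ := h b hb
      exact hab (congrArg i (huniq w hw k l ha hb))
    by_cases hcw : c w = true
    · exact ⟨w, z, hwz, hw, hz, hcw⟩
    · refine ⟨z, w, hwz.symm, hz, hw, ?_⟩
      have := c.valid hwz
      cases h : c z <;> simp_all
  -- Both arcs between k and l have length at least n - 3 and their sum is n ≥ 6, so r = 3 and both
  -- have length 3; for r > 3 such k and l do not exist.
  have hanti : ∀ k l, F.Adj w (i k) → F.Adj z (i l) → (l - k).val = r := by
    intro k l hk hl
    have hkl : k ≠ l := by
      rintro rfl
      have h1 := c.valid hwz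
      have h2 := c.valid hk
      have h3 := c.valid hl
      cases h : c w <;> cases h' : c z <;> cases h'' : c (i k) <;> simp_all
    have h1 := le_add_three_of_outer_edge hn2 hg.ge hi hadj hw hz hwz hk hl
    have h2 := le_add_three_of_outer_edge hn2 hg.ge hi hadj hz hw hwz.symm hl hk
    have h3 := Fin.val_sub_add_val_sub hkl
    omega
  -- The numbering is restarted at the neighbour of w, failing that at the neighbour of z, and is
  -- kept if there is neither.
  obtain ⟨k₀, hk₀⟩ : ∃ k₀, ∀ k, F.Adj w (i k) ∨ F.Adj z (i k) →
      (k - k₀).val = 0 ∨ (k - k₀).val = r := by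
    by_cases h : ∃ k, F.Adj w (i k)
    · obtain ⟨k, hk⟩ := h
      refine ⟨k, fun l hl => ?_⟩
      rcases hl with hl | hl
      · left; rw [huniq w hw l k hl hk, sub_self, Fin.val_zero]
      · right; exact hanti k l hk hl
    · push Not at h
      by_cases h' : ∃ k, F.Adj z (i k)
      · obtain ⟨k, hk⟩ := h'
        refine ⟨k, fun l hl => .inl ?_⟩
        rw [huniq z hz l k (hl.resolve_left (h l)) hk, sub_self, Fin.val_zero]
      · push Not at h'
        exact ⟨0, fun l hl => (hl.elim (h l) (h' l)).elim⟩
  obtain ⟨hi', hadj', hrange⟩ := rotate_cycle hi hadj k₀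
  rw [bigraphDensity_eq_integral_edgeProd]
  refine (le_abs_self _).trans ?_
  refine abs_integral_edgeProd_le_of_outer_edge hn (by omega) hU (coloring_add_one c hadj')
    (parityColor_add_one hn (by omega)) hi' (cycleEdge_mem_bigraphEdges c hadj')
    (fun e he => eq_cycleEdge_of_mem_bigraphEdges hn2 hg.ge c hi' hadj' he)
    (bigraphEdges_color c) (w := w) (z := z) (mem_bigraphEdges.2 ⟨hwz, hcw⟩)
    (by rwa [hrange]) (by rwa [hrange]) ?_
  intro k hk
  have h := hk₀ (k + k₀) (hk.imp (fun h => (mem_bigraphEdges.1 h).1)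
    fun h => (mem_bigraphEdges.1 h).1.symm)
  rwa [add_sub_cancel_right] at h

theorem bigraphDensity_le_of_avoids (hg : F.egirth = ((4 : ℕ) : ℕ∞)) [DecidableRel F.Adj]
    (c : F.Coloring Bool) (hdeg : ∀ v, 2 ≤ F.degree v) {i : Fin 4 → V} (hi : i.Injective)
    (hadj : ∀ k, F.Adj (i k) (i (k + 1))) {w b : V} (hw : c w = true) (hb : c b = false)
    (hwb : ¬ F.Adj w b) (hwi : w ∉ Set.range i) {U : I × I → ℝ} (hU : IsUnitBounded U) :
    bigraphDensity F c U ≤ √√(codegreeSq U) * codegreeSq U := by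
  obtain ⟨v₁, v₂, hv, hv₁, hv₂⟩ := SimpleGraph.exists_ne_adj_of_two_le_degree w (hdeg w)
  obtain ⟨p, q, hpq, hp, hq⟩ := SimpleGraph.exists_ne_adj_of_two_le_degree b (hdeg b)
  have hcol : ∀ p, F.Adj b p → c p = true := by
    intro p hp
    have := c.valid hp
    cases h : c p <;> simp_all
  -- The cycle is renumbered to start in the class opposite to w, so that w can be joined to the
  -- nodes 0 and 2 only.
  obtain ⟨k₀, hk₀⟩ : ∃ k₀ : Fin 4, c (i (0 + k₀)) = false := by
    by_cases h : c (i 0) = false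
    · exact ⟨0, by simpa using h⟩
    · refine ⟨1, ?_⟩
      rw [coloring_add_one c hadj]
      simpa using h
  obtain ⟨hi', hadj', hrange⟩ := rotate_cycle hi hadj k₀
  rw [bigraphDensity_eq_integral_edgeProd]
  refine (le_abs_self _).trans ?_
  refine abs_integral_edgeProd_le_of_not_mem hU (coloring_add_one c hadj') hi'
    (cycleEdge_mem_bigraphEdges c hadj')
    (fun e he => eq_cycleEdge_of_mem_bigraphEdges (by norm_num) hg.ge c hi' hadj' he)
    (bigraphEdges_color c) (by rwa [hrange]) hw hv (mem_bigraphEdges.2 ⟨hv₁, hw⟩)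
    (mem_bigraphEdges.2 ⟨hv₂, hw⟩) (fun h => hwb (mem_bigraphEdges.1 h).1) hpq
    (mem_bigraphEdges.2 ⟨hp.symm, hcol p hp⟩) (mem_bigraphEdges.2 ⟨hq.symm, hcol q hq⟩) ?_
  intro k hk
  have h1 := (bigraphEdges_color c _ hk).2
  have h2 := coloring_add_one c hadj'
  have h3 := h2 0
  have h4 := h2 2
  have h5 := h2 1
  fin_cases k
  · left; rfl
  · simp_all
  · right; rfl
  · simp_all

theorem bigraphDensity_le_of_four (hg : F.egirth = ((4 : ℕ) : ℕ∞)) [DecidableRel F.Adj]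
    (c : F.Coloring Bool) (hdeg : ∀ v, 2 ≤ F.degree v)
    (hcomplete : ¬ IsCompleteBipartiteGraph F) {U : I × I → ℝ} (hU : IsUnitBounded U) :
    bigraphDensity F c U ≤ √√(codegreeSq U) * codegreeSq U := by
  obtain ⟨-, i, hi, hadj⟩ := SimpleGraph.exists_cycle_of_egirth_eq hg
  obtain ⟨w, b, hw, hb, hwb⟩ : ∃ w b, c w = true ∧ c b = false ∧ ¬ F.Adj w b := by
    by_contra! h
    exact hcomplete (isCompleteBipartiteGraph_of_forall_adj c h)
  by_cases hwi : w ∈ Set.range i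
  · have hbi : b ∉ Set.range i := by
      rintro ⟨l, rfl⟩
      obtain ⟨k, rfl⟩ := hwi
      have h1 := hadj 0
      have h2 := hadj 1
      have h3 := hadj 2
      have h4 := hadj 3
      have hc := coloring_add_one c hadj
      have c1 := hc 0
      have c2 := hc 1
      have c3 := hc 2
      have hwb' := fun h => hwb (SimpleGraph.Adj.symm h)
      -- In a 4-cycle any two nodes of different colours are adjacent, so w and b cannot both lie on
      -- it.
      fin_cases k <;> fin_cases l <;> simp_all
    rw [← bigraphDensity_flip c U, ← codegreeSq_comp_swap hU]
    refine bigraphDensity_le_of_avoids hg c.flip hdeg hi hadj (w := b) (b := w) ?_ ?_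
      (fun h => hwb h.symm) hbi (hU.comp measurable_swap)
    · rw [SimpleGraph.Coloring.flip_apply, hb, Bool.not_false]
    · rw [SimpleGraph.Coloring.flip_apply, hw, Bool.not_true]
  · exact bigraphDensity_le_of_avoids hg c hdeg hi hadj hw hb hwb hwi hU

end Main

theorem mainTheorem6 {V : Type*} [Fintype V] (F : SimpleGraph V) [DecidableRel F.Adj]
    (c : F.Coloring Bool) (r : ℕ)
    (hdeg : ∀ v, 2 ≤ F.degree v)
    (hgirth : F.egirth = ((2 * r : ℕ) : ℕ∞))
    (hcycle : ¬ IsSingleCycle F)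
    (hcomplete : ¬ IsCompleteBipartiteGraph F) :
    ∀ U : I × I → ℝ, IsUnitKernel U →
      bigraphDensity F c U ≤
        evenCycleDensity r U * evenCycleDensity 2 U ^ (1 / 4 : ℝ) := by
  intro U hU
  obtain ⟨U', hU', hae⟩ := hU.exists_isUnitBounded
  rw [evenCycleDensity, evenCycleDensity, bigraphDensity_congr_ae _ _ hae,
    bigraphDensity_congr_ae _ _ hae, bigraphDensity_congr_ae _ _ hae,
    ← evenCycleDensity, ← evenCycleDensity, evenCycleDensity_two_eq hU', mul_comm]
  have hpow : codegreeSq U' ^ (1 / 4 : ℝ) = √√(codegreeSq U') := by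
    rw [Real.sqrt_eq_rpow, Real.sqrt_eq_rpow, ← Real.rpow_mul (codegreeSq_nonneg U')]
    norm_num
  rw [hpow]
  -- A cycle has at least three nodes, so r ≥ 2 and the cases r = 2 and r ≥ 3 are exhaustive.
  have h3 : 3 ≤ 2 * r := by
    have := F.three_le_egirth
    rw [hgirth] at this
    exact_mod_cast this
  have : NeZero (2 * r) := ⟨by omega⟩
  by_cases hr : r = 2
  · subst hr
    rw [evenCycleDensity_two_eq hU']
    exact bigraphDensity_le_of_four hgirth c hdeg hcomplete hU'
  · rw [evenCycleDensity_eq (by omega)]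
    exact bigraphDensity_le_of_six_le rfl (by omega) c hdeg hgirth hcycle hU'
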